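/- **Language.** Let $x,f$ range over a countable set of variables, $q\in\mathbb Q_{\ge0}$, $p\in\mathbb Q\cap[0,1]$. Expressions are $$e::= x\mid \langle\rangle\mid[\,]\mid x_1::x_2\mid \mathsf{case}\,x\,\{[\,]\hookrightarrow e_0\mid x_1::x_2\hookrightarrow e_1\}\mid\mathsf{fun}\,f\,x=e\mid x_1\,x_2\mid\mathsf{tick}\{q\}\mid\mathsf{let}\,x=e_1\,\mathsf{in}\,e_2\mid\mathsf{share}\,x\,\mathsf{as}\,x_1,x_2\,\mathsf{in}\,e\mid\mathsf{flip}\,p\,\{e_1\mid e_2\}\mid\mathsf{prob}\,p\mid\mathsf{flip}\,x\,\{e_1\mid e_2\}.$$ Values are $\langle\rangle$, $[\,]$, $v_1::v_2$, closures $\mathsf{clo}(V,f,x,e)$ and $\mathsf{prob}\,p$, where an environment $V$ maps variables to values. **Types.** $\tau::=\mathsf{unit}\mid L(A)\mid A\to B\mid \mathsf P(q_H,q_T)$ and $A,B::=\langle\tau,q\rangle$, with $q,q_H,q_T\in\mathbb Q_{\ge0}$. Potentials: $\Phi(v:\langle\tau,q\rangle)=\Phi(v:\tau)+q$; $\Phi(\langle\rangle:\mathsf{unit})=\Phi([\,]:L(A))=\Phi(\mathsf{clo}(\ldots):A\to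 B)=0$; $\Phi(v_1::v_2:L(A))=\Phi(v_1:A)+\Phi(v_2:L(A))$; $\Phi(\mathsf{prob}\,p:\mathsf P(q_H,q_T))=p\,q_H+(1-p)q_T$. For a context $\Gamma$ (a finite map from variables to types $\tau$), $\Phi(V:\Gamma)=\sum_{x\in\mathrm{dom}\,\Gamma}\Phi(V(x):\Gamma(x))$. *Scaling* $p\times\tau$ multiplies every annotation of $\tau$ by $p$, and $|\tau|$ replaces every annotation by $0$; both leave arrow types unchanged. *Sharing* $\tau\curlyvee(\tau_1,\tau_2)$: the three types have the same shape, every annotation of $\tau$ is the sum of the corresponding ones of $\tau_1$ and $\tau_2$, and arrow types are identical in all three. All three notions extend pointwise to contexts (with equal domains). *Subtyping* $\tau_1<:\tau_2$ is the structural relation in which annotations decrease from left to right, lists are covariant, and arrows are contravariant in the argument and covariant in the result; $\langle\tau_1,q_1\rangle<:\langle\tau_2,q_2\rangle$ iff $\tau_1<:\tau_2$ and $q_1\ge q_2$. **Typing.** $\Gamma;q\vdash e:A$ is defined inductively by the following rules, up to renaming of bound variables; commas join contexts with disjoint domains. - $x:\tau;0\vdash x:\langle\tau,0\rangle$; $\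 \cdot;0\vdash\langle\rangle:\langle\mathsf{unit},0\rangle$; $\ \cdot;0\vdash[\,]:\langle L(A),0\rangle$; $\ \cdot;q\vdash\mathsf{tick}\{q\}:\langle\mathsf{unit},0\rangle$; $\ \cdot;p\,q_H+(1-p)q_T\vdash\mathsf{prob}\,p:\langle\mathsf P(q_H,q_T),0\rangle$. - $x_1:\tau,x_2:L(\langle\tau,p\rangle);p\vdash x_1::x_2:\langle L(\langle\tau,p\rangle),0\rangle$; $\ x_1:\langle\tau,q\rangle\to B,\,x_2:\tau;q\vdash x_1\,x_2:B$. - If $\Gamma;q\vdash e_0:B$ and $\Gamma,x_1:\tau,x_2:L(\langle\tau,p\rangle);q+p\vdash e_1:B$, then $\Gamma,x:L(\langle\tau,p\rangle);q\vdash\mathsf{case}\,x\,\{[\,]\hookrightarrow e_0\mid x_1::x_2\hookrightarrow e_1\}:B$. - If $\Gamma_1;q\vdash e_1:\langle\tau,p\rangle$ and $\Gamma_2,x:\tau;p\vdash e_2:B$, then $\Gamma_1,\Gamma_2;q\vdash\mathsf{let}\,x=e_1\,\mathsf{in}\,e_2:B$. - If $\Gamma=|\Gamma|$ and $\Gamma,f:\langle\tau,q\rangle\to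 B,x:\tau;q\vdash e:B$, then $\Gamma;0\vdash\mathsf{fun}\,f\,x=e:\langle\langle\tau,q\rangle\to B,0\rangle$. - If $\tau\curlyvee(\tau_1,\tau_2)$ and $\Gamma,x_1:\tau_1,x_2:\tau_2;q\vdash e:B$, then $\Gamma,x:\tau;q\vdash\mathsf{share}\,x\,\mathsf{as}\,x_1,x_2\,\mathsf{in}\,e:B$. - If $\Gamma\curlyvee(p\times\Gamma_1,(1-p)\times\Gamma_2)$, $q=p\,q_1+(1-p)q_2$ and $\Gamma_i;q_i\vdash e_i:A$ for $i=1,2$, then $\Gamma;q\vdash\mathsf{flip}\,p\,\{e_1\mid e_2\}:A$. - If $\Gamma;q+q_H\vdash e_1:A$ and $\Gamma;q+q_T\vdash e_2:A$, then $\Gamma,x:\mathsf P(q_H,q_T);q\vdash\mathsf{flip}\,x\,\{e_1\mid e_2\}:A$. - If $\Gamma;q\vdash e:\langle\tau',q'\rangle$ and $\tau'<:\tau$, then $\Gamma;q\vdash e:\langle\tau,q'\rangle$. If $\Gamma,x:\tau;q\vdash e:B$ and $\tau'<:\tau$, then $\Gamma,x:\tau';q\vdash e:B$. If $\Gamma;q\vdash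 e:B$, then $\Gamma,x:\tau;q\vdash e:B$. If $\Gamma;p\vdash e:\langle\tau,p'\rangle$, $q\ge p$ and $q-q'\ge p-p'$, then $\Gamma;q\vdash e:\langle\tau,q'\rangle$. Values are typed by $\langle\rangle:\mathsf{unit}$; $\mathsf{prob}\,p:\mathsf P(q_H,q_T)$; $[\,]:L(A)$; $v_1::v_2:L(A)$ if $v_1:A$ and $v_2:L(A)$; $v:\langle\tau,q\rangle$ if $v:\tau$; and $\mathsf{clo}(V,f,x,e):\langle\tau,q\rangle\to B$ if there is $\Gamma$ with $V:\Gamma$ and $|\Gamma|,f:\langle\tau,q\rangle\to B,x:\tau;q\vdash e:B$. Here $V:\Gamma$ means $V(x):\Gamma(x)$ for all $x\in\mathrm{dom}\,\Gamma$. **Semantics.** Let $\circ$ be a dummy value for partial evaluations. The judgment $V\vdash e\Rightarrow_n\mu$, where $n\in\mathbb N$ and $\mu$ is a (discrete, full) probability distribution on $(\mathsf{Val}\cup\{\circ\})\times(\mathbb Q_{\ge0}\cup\{\infty\})$, is defined inductively; $\delta$ denotes point distributions. - $V\vdash e\Rightarrow_0\delta(\circ,0)$ for every $e$. - For $n\ge1$,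 $V\vdash e\Rightarrow_n\delta(v,c)$, where $(v,c)$ is $(V(x),0)$ for $e=x$; $(V(x_1)::V(x_2),0)$ for $e=x_1::x_2$; $(\langle\rangle,q)$ for $e=\mathsf{tick}\{q\}$; $(\mathsf{clo}(V,f,x,e'),0)$ for $e=\mathsf{fun}\,f\,x=e'$; and $(e,0)$ for $e\in\{\langle\rangle,[\,],\mathsf{prob}\,p\}$. - $V\vdash e\Rightarrow_{n+1}\mu$ in the following cases: $e=\mathsf{case}\,x\,\{\ldots\}$, and either $V(x)=[\,]$ and $V\vdash e_0\Rightarrow_n\mu$, or $V(x)=v_1::v_2$ and $V[x_1\mapsto v_1,x_2\mapsto v_2]\vdash e_1\Rightarrow_n\mu$; $e=x_1\,x_2$, $V(x_1)=\mathsf{clo}(V',f,x,e')$ and $V'[f\mapsto V(x_1),x\mapsto V(x_2)]\vdash e'\Rightarrow_n\mu$; $e=\mathsf{share}\,x\,\mathsf{as}\,x_1,x_2\,\mathsf{in}\,e'$ and $V[x_1\mapsto V(x),x_2\mapsto V(x)]\vdash e'\Rightarrow_n\mu$. - If $V\vdash e_i\Rightarrow_n\mu_i$ for $i=1,2$, then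 $V\vdash e\Rightarrow_{n+1}p\,\mu_1+(1-p)\mu_2$ for $e=\mathsf{flip}\,p\,\{e_1\mid e_2\}$, and for $e=\mathsf{flip}\,x\,\{e_1\mid e_2\}$ when $V(x)=\mathsf{prob}\,p$. - If $V\vdash e_1\Rightarrow_n\mu$ and $V[x\mapsto v_1]\vdash e_2\Rightarrow_n\mu_{(v_1,q_1)}$ for all $(v_1,q_1)\in\mathrm{supp}\,\mu$ with $v_1\ne\circ$, then $$V\vdash\mathsf{let}\,x=e_1\,\mathsf{in}\,e_2\Rightarrow_{n+1}\sum_{q_1}\mu(\circ,q_1)\,\delta(\circ,q_1)+\sum_{(v_1,q_1):v_1\ne\circ}\ \sum_{(v_2,q_2)}\mu(v_1,q_1)\,\mu_{(v_1,q_1)}(v_2,q_2)\,\delta(v_2,q_1+q_2).$$ Write $\mu_1\sqsubseteq\mu_2$ if $\mu_1(v,q)\le\mu_2(v,q)$ for all $v\ne\circ$ and all $q$, and $\mu_1((\mathsf{Val}\cup\{\circ\})\times[0,q])\ge\mu_2((\mathsf{Val}\cup\{\circ\})\times[0,q])$ for all $q\in\mathbb Q_{\ge0}\cup\{\infty\}$.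 The full distribution $[\![e]\!]^V=\bigsqcup_n\mu_n$ is the $\sqsubseteq$-least upper bound, among the probability distributions on $(\mathsf{Val}\cup\{\circ\})\times(\mathbb Q_{\ge0}\cup\{\infty\})$, of a chain $\mu_0\sqsubseteq\mu_1\sqsubseteq\cdots$ with $V\vdash e\Rightarrow_n\mu_n$ for all $n$. **Theorem (soundness of AARA, improved).** Let $\Gamma;q\vdash e:A$ and $V:\Gamma$. Then $[\![e]\!]^V$ exists, $\Phi(v_0:A)$ is defined whenever $v_0\neq\circ$ and $[\![e]\!]^V(v_0,q_0)>0$ for some $q_0$, and $$\Phi(V:\Gamma)+q\ \ge\ \sum_{q_0}[\![e]\!]^V(\circ,q_0)\cdot q_0\ +\sum_{(v_0,q_0):v_0\ne\circ}[\![e]\!]^V(v_0,q_0)\cdot\bigl(\Phi(v_0:A)+q_0\bigr),$$ where $q_0$ ranges over $\mathbb Q_{\ge0}\cup\{\infty\}$ and $0\cdot\infty=0$. -/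

import Mathlib

open scoped NNReal ENNReal NNRat

namespace AARA

/-! ### Syntax -/

/-- Program variables. -/
abbrev Var := ℕ

/-- Rational probabilities `0 ≤ p ≤ 1`. -/
abbrev Prob := {p : ℚ≥0 // p ≤ 1}

/-- The complementary probability `1 - p`. -/
def Prob.compl (p : Prob) : Prob := ⟨1 - p.1, tsub_le_self⟩

/-- Expressions in share-let normal form. -/
inductive Expr : Type
  | var (x : Var)
  | triv
  | nil
  | cons (x₁ x₂ : Var)
  /-- `case x { [] ↪ e₀ | x₁ :: x₂ ↪ e₁ }` -/
  | matL (x : Var) (e₀ : Expr) (x₁ x₂ : Var) (e₁ : Expr)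
  /-- the recursive function `fun f x = e` -/
  | fn (f x : Var) (e : Expr)
  | app (x₁ x₂ : Var)
  | tick (q : ℚ≥0)
  /-- `let x = e₁ in e₂` -/
  | letE (e₁ : Expr) (x : Var) (e₂ : Expr)
  /-- `share x as x₁, x₂ in e` -/
  | share (x x₁ x₂ : Var) (e : Expr)
  /-- `flip p { H ↪ e₁ | T ↪ e₂ }` -/
  | flip (p : Prob) (e₁ e₂ : Expr)
  | prob (p : Prob)
  /-- `flip x { H ↪ e₁ | T ↪ e₂ }` with a variable `x` of probability type -/
  | flipS (x : Var) (e₁ e₂ : Expr)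

/-- Values; `clo V f x e` is the closure of `fun f x = e` in the environment `V`. -/
inductive Val : Type
  | triv
  | nil
  | cons (v₁ v₂ : Val)
  | clo (V : Var → Val) (f x : Var) (e : Expr)
  | prob (p : Prob)

/-- Evaluation environments. -/
abbrev Env := Var → Val

/-! ### Types -/

/-- Types. A potential-annotated type is a pair `⟨τ, q⟩`; `list τ q` is the type of lists with
elements of annotated type `⟨τ, q⟩`, and `arr τ q σ r` is the arrow type `⟨τ, q⟩ → ⟨σ, r⟩`. -/
inductive Ty : Type
  | unit
  | list (τ : Ty) (q : ℚ≥0)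
  | arr (τ : Ty) (q : ℚ≥0) (σ : Ty) (r : ℚ≥0)
  | prob (qH qT : ℚ≥0)

/-- Potential-annotated types `⟨τ, q⟩`. -/
structure PTy : Type where
  ty : Ty
  pot : ℚ≥0

/-- The potential `Φ(v : τ)`, defined when the value `v` has the form that `τ` prescribes
(see `Val.Fits`); the last clause is a dummy for the other pairs. -/
def Val.potential : Val → Ty → ℚ≥0
  | .triv, .unit => 0
  | .nil, .list _ _ => 0
  | .cons v₁ v₂, .list τ q => (v₁.potential τ + q) + v₂.potential (.list τ q)
  | .clo _ _ _ _, .arr _ _ _ _ => 0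
  | .prob p, .prob qH qT => qH * p.1 + qT * p.compl.1
  | _, _ => 0

/-- `Φ(v : ⟨τ, q⟩) = Φ(v : τ) + q`. -/
def Val.ppotential (v : Val) (A : PTy) : ℚ≥0 := v.potential A.ty + A.pot

/-- `v.Fits τ`: the defining equations of the potential apply to `v` and `τ`, that is,
`Φ(v : τ)` is meaningful. -/
def Val.Fits : Val → Ty → Prop
  | .triv, .unit => True
  | .nil, .list _ _ => True
  | .cons v₁ v₂, .list τ q => v₁.Fits τ ∧ v₂.Fits (.list τ q)
  | .clo _ _ _ _, .arr _ _ _ _ => True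
  | .prob _, .prob _ _ => True
  | _, _ => False

/-- Potential scaling `p × τ`. -/
def Ty.scale (p : ℚ≥0) : Ty → Ty
  | .unit => .unit
  | .list τ q => .list (τ.scale p) (p * q)
  | .arr τ q σ r => .arr τ q σ r
  | .prob qH qT => .prob (p * qH) (p * qT)

/-- `|τ|`: all potential annotations (outside of arrow types) are replaced by `0`. -/
def Ty.zero : Ty → Ty
  | .unit => .unit
  | .list τ _ => .list τ.zero 0
  | .arr τ q σ r => .arr τ q σ r
  | .prob _ _ => .prob 0 0

/-- The sharing relation `τ ⋎ (τ₁, τ₂)`. -/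
inductive Share : Ty → Ty → Ty → Prop
  | unit : Share .unit .unit .unit
  | list {τ τ₁ τ₂ : Ty} {q q₁ q₂ : ℚ≥0} (hq : q = q₁ + q₂) (hτ : Share τ τ₁ τ₂) :
      Share (.list τ q) (.list τ₁ q₁) (.list τ₂ q₂)
  | arr {τ σ : Ty} {q r : ℚ≥0} : Share (.arr τ q σ r) (.arr τ q σ r) (.arr τ q σ r)
  | prob {qH qT qH₁ qT₁ qH₂ qT₂ : ℚ≥0} (hH : qH = qH₁ + qH₂) (hT : qT = qT₁ + qT₂) :
      Share (.prob qH qT) (.prob qH₁ qT₁) (.prob qH₂ qT₂)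

/-- The subtyping relation `τ₁ <: τ₂`; on annotated types,
`⟨τ₁, q₁⟩ <: ⟨τ₂, q₂⟩` means `τ₁ <: τ₂` and `q₁ ≥ q₂`. -/
inductive SubTy : Ty → Ty → Prop
  | unit : SubTy .unit .unit
  | list {τ₁ τ₂ : Ty} {q₁ q₂ : ℚ≥0} (hτ : SubTy τ₁ τ₂) (hq : q₂ ≤ q₁) :
      SubTy (.list τ₁ q₁) (.list τ₂ q₂)
  | arr {τ₁ τ₂ σ₁ σ₂ : Ty} {q₁ q₂ r₁ r₂ : ℚ≥0}
      (hτ : SubTy τ₂ τ₁) (hq : q₁ ≤ q₂) (hσ : SubTy σ₁ σ₂) (hr : r₂ ≤ r₁) :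
      SubTy (.arr τ₁ q₁ σ₁ r₁) (.arr τ₂ q₂ σ₂ r₂)
  | prob {qH₁ qT₁ qH₂ qT₂ : ℚ≥0} (hH : qH₂ ≤ qH₁) (hT : qT₂ ≤ qT₁) :
      SubTy (.prob qH₁ qT₁) (.prob qH₂ qT₂)

/-! ### Contexts -/

/-- Typing contexts. Every context of a derivable judgment has a finite domain
(`Typing.finite_dom`). -/
abbrev Ctx := Var → Option Ty

namespace Ctx

def empty : Ctx := fun _ => none

/-- `Γ, x : τ`. In a premise, a new binding of `x` shadows an old one; a rule whose conclusion
has this form demands `Γ x = none` where that is needed. -/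
def ext (Γ : Ctx) (x : Var) (τ : Ty) : Ctx := Function.update Γ x (some τ)

/-- No variable is bound in both contexts. -/
def Disj (Γ₁ Γ₂ : Ctx) : Prop := ∀ x, Γ₁ x = none ∨ Γ₂ x = none

/-- `Γ₁, Γ₂` for disjoint contexts. -/
def join (Γ₁ Γ₂ : Ctx) : Ctx := fun x => (Γ₁ x).or (Γ₂ x)

def scale (p : ℚ≥0) (Γ : Ctx) : Ctx := fun x => (Γ x).map (Ty.scale p)

def zero (Γ : Ctx) : Ctx := fun x => (Γ x).map Ty.zero

/-- The sharing relation, extended to contexts with the same domain. -/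
def Share (Γ Γ₁ Γ₂ : Ctx) : Prop :=
  ∀ x, (Γ x = none ∧ Γ₁ x = none ∧ Γ₂ x = none) ∨
    ∃ τ τ₁ τ₂, Γ x = some τ ∧ Γ₁ x = some τ₁ ∧ Γ₂ x = some τ₂ ∧ AARA.Share τ τ₁ τ₂

end Ctx

/-! ### Typing -/

/-- The typing judgment `Γ; q ⊢ e : A` of linear AARA. -/
inductive Typing : Ctx → ℚ≥0 → Expr → PTy → Prop
  | var {x : Var} {τ : Ty} : Typing (Ctx.empty.ext x τ) 0 (.var x) ⟨τ, 0⟩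
  | triv : Typing Ctx.empty 0 .triv ⟨.unit, 0⟩
  | nil {τ : Ty} {p : ℚ≥0} : Typing Ctx.empty 0 .nil ⟨.list τ p, 0⟩
  | cons {x₁ x₂ : Var} {τ : Ty} {p : ℚ≥0} (hx : x₁ ≠ x₂) :
      Typing ((Ctx.empty.ext x₁ τ).ext x₂ (.list τ p)) p (.cons x₁ x₂) ⟨.list τ p, 0⟩
  | matL {Γ : Ctx} {x x₁ x₂ : Var} {τ : Ty} {p q : ℚ≥0} {e₀ e₁ : Expr} {B : PTy}
      (hx : Γ x = none) (h₀ : Typing Γ q e₀ B)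
      (h₁ : Typing ((Γ.ext x₁ τ).ext x₂ (.list τ p)) (q + p) e₁ B) :
      Typing (Γ.ext x (.list τ p)) q (.matL x e₀ x₁ x₂ e₁) B
  | tick {q : ℚ≥0} : Typing Ctx.empty q (.tick q) ⟨.unit, 0⟩
  | letE {Γ₁ Γ₂ : Ctx} {x : Var} {τ : Ty} {p q : ℚ≥0} {e₁ e₂ : Expr} {B : PTy}
      (hd : Γ₁.Disj Γ₂) (h₁ : Typing Γ₁ q e₁ ⟨τ, p⟩) (h₂ : Typing (Γ₂.ext x τ) p e₂ B) :
      Typing (Γ₁.join Γ₂) q (.letE e₁ x e₂) B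
  | app {x₁ x₂ : Var} {τ : Ty} {q : ℚ≥0} {B : PTy} (hx : x₁ ≠ x₂) :
      Typing ((Ctx.empty.ext x₁ (.arr τ q B.ty B.pot)).ext x₂ τ) q (.app x₁ x₂) B
  | fn {Γ : Ctx} {f x : Var} {τ : Ty} {q : ℚ≥0} {e : Expr} {B : PTy}
      (hΓ : Γ = Γ.zero) (h : Typing ((Γ.ext f (.arr τ q B.ty B.pot)).ext x τ) q e B) :
      Typing Γ 0 (.fn f x e) ⟨.arr τ q B.ty B.pot, 0⟩
  | share {Γ : Ctx} {x x₁ x₂ : Var} {τ τ₁ τ₂ : Ty} {q : ℚ≥0} {e : Expr} {B : PTy}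
      (hx : Γ x = none) (hτ : Share τ τ₁ τ₂)
      (h : Typing ((Γ.ext x₁ τ₁).ext x₂ τ₂) q e B) :
      Typing (Γ.ext x τ) q (.share x x₁ x₂ e) B
  | flip {Γ Γ₁ Γ₂ : Ctx} {p : Prob} {q q₁ q₂ : ℚ≥0} {e₁ e₂ : Expr} {A : PTy}
      (hΓ : Γ.Share (Γ₁.scale p.1) (Γ₂.scale p.compl.1))
      (hq : q = p.1 * q₁ + p.compl.1 * q₂)
      (h₁ : Typing Γ₁ q₁ e₁ A) (h₂ : Typing Γ₂ q₂ e₂ A) :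
      Typing Γ q (.flip p e₁ e₂) A
  | prob {p : Prob} {q qH qT : ℚ≥0} (hq : q = p.1 * qH + p.compl.1 * qT) :
      Typing Ctx.empty q (.prob p) ⟨.prob qH qT, 0⟩
  | flipS {Γ : Ctx} {x : Var} {q qH qT : ℚ≥0} {e₁ e₂ : Expr} {A : PTy}
      (hx : Γ x = none) (h₁ : Typing Γ (q + qH) e₁ A) (h₂ : Typing Γ (q + qT) e₂ A) :
      Typing (Γ.ext x (.prob qH qT)) q (.flipS x e₁ e₂) A
  | sub {Γ : Ctx} {q q' : ℚ≥0} {e : Expr} {τ τ' : Ty}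
      (h : Typing Γ q e ⟨τ', q'⟩) (hτ : SubTy τ' τ) : Typing Γ q e ⟨τ, q'⟩
  | sup {Γ : Ctx} {x : Var} {q : ℚ≥0} {e : Expr} {τ τ' : Ty} {B : PTy}
      (h : Typing (Γ.ext x τ) q e B) (hτ : SubTy τ' τ) : Typing (Γ.ext x τ') q e B
  | weak {Γ : Ctx} {x : Var} {q : ℚ≥0} {e : Expr} {τ : Ty} {B : PTy}
      (hx : Γ x = none) (h : Typing Γ q e B) : Typing (Γ.ext x τ) q e B
  /-- The second side condition is `q - q' ≥ p - p'`, written without subtraction. -/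
  | relax {Γ : Ctx} {p p' q q' : ℚ≥0} {e : Expr} {τ : Ty}
      (h : Typing Γ p e ⟨τ, p'⟩) (hq : p ≤ q) (hq' : p + q' ≤ q + p') : Typing Γ q e ⟨τ, q'⟩

/-- The typing judgment `v : τ` for values; `v : ⟨τ, q⟩` means `v : τ`. -/
inductive HasType : Val → Ty → Prop
  | triv : HasType .triv .unit
  | prob {p : Prob} {qH qT : ℚ≥0} : HasType (.prob p) (.prob qH qT)
  | nil {τ : Ty} {q : ℚ≥0} : HasType .nil (.list τ q)
  | cons {v₁ v₂ : Val} {τ : Ty} {q : ℚ≥0} (h₁ : HasType v₁ τ) (h₂ : HasType v₂ (.list τ q)) :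
      HasType (.cons v₁ v₂) (.list τ q)
  | clo {V : Env} {Γ : Ctx} {f x : Var} {τ : Ty} {q : ℚ≥0} {e : Expr} {B : PTy}
      (hV : ∀ y σ, Γ y = some σ → HasType (V y) σ)
      (h : Typing ((Γ.zero.ext f (.arr τ q B.ty B.pot)).ext x τ) q e B) :
      HasType (.clo V f x e) (.arr τ q B.ty B.pot)

/-- `V : Γ`. -/
def Env.HasCtx (V : Env) (Γ : Ctx) : Prop := ∀ x τ, Γ x = some τ → HasType (V x) τ

/-! ### Costs, distributions and the semantics with partial evaluations -/

/-- Non-negative rational numbers as extended non-negative reals. -/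
noncomputable def ratToENNReal (q : ℚ≥0) : ℝ≥0∞ := ((q : ℝ≥0) : ℝ≥0∞)

/-- Costs: non-negative rational numbers or `∞`. -/
abbrev Cost := WithTop ℚ≥0

noncomputable def Cost.toENNReal : Cost → ℝ≥0∞
  | ⊤ => ⊤
  | (q : ℚ≥0) => ratToENNReal q

/-- `Φ(V : Γ)`, the sum of `Φ(V x : Γ x)` over the domain of `Γ`. -/
noncomputable def Env.potential (V : Env) (Γ : Ctx) : ℝ≥0∞ :=
  ∑' x : Var, match Γ x with
    | some τ => ratToENNReal ((V x).potential τ)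
    | none => 0

/-- Results of an evaluation: a value or the dummy value `∘` (here `none`) for a partial
evaluation, together with the cost. -/
abbrev Outcome := Option Val × Cost

/-- The distribution `p · μ₁ + (1 - p) · μ₂`. -/
noncomputable def mix {α : Type} (p : Prob) (μ₁ μ₂ : PMF α) : PMF α :=
  ⟨fun a => ratToENNReal p.1 * μ₁ a + ratToENNReal p.compl.1 * μ₂ a, by
    have h : ratToENNReal p.1 + ratToENNReal p.compl.1 = 1 := by
      unfold ratToENNReal Prob.compl
      rw [← ENNReal.coe_add, ← NNRat.cast_add, add_tsub_cancel_of_le p.2]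
      simp
    rw [ENNReal.summable.hasSum_iff, ENNReal.tsum_add, ENNReal.tsum_mul_left,
      ENNReal.tsum_mul_left, μ₁.tsum_coe, μ₂.tsum_coe, mul_one, mul_one, h]⟩

/-- Sequential composition: the distribution
`∑ μ(∘, q₁) · δ(∘, q₁) + ∑ ∑ μ(v₁, q₁) · κ(v₁, q₁)(v₂, q₂) · δ(v₂, q₁ + q₂)`, where the first sum
is over all `q₁`, the second one over all `(v₁, q₁)` with `v₁ ≠ ∘`, and the third one over all
`(v₂, q₂)`, including `v₂ = ∘`. -/
noncomputable def seqDist (μ : PMF Outcome) (κ : Val → Cost → PMF Outcome) : PMF Outcome :=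
  μ.bind fun o => match o with
    | (none, q₁) => PMF.pure (none, q₁)
    | (some v₁, q₁) => (κ v₁ q₁).map fun o₂ => (o₂.1, q₁ + o₂.2)

/-- The judgment `V ⊢ e ⇒ₙ μ` of the distribution-based semantics with partial evaluations:
in the environment `V`, the expression `e` reduces to the full distribution `μ` within
derivation depth `n`. -/
inductive Step : Env → Expr → ℕ → PMF Outcome → Prop
  | base {V : Env} {e : Expr} : Step V e 0 (PMF.pure (none, 0))
  | var {V : Env} {n : ℕ} {x : Var} : Step V (.var x) (n + 1) (PMF.pure (some (V x), 0))
  | triv {V : Env} {n : ℕ} : Step V .triv (n + 1) (PMF.pure (some .triv, 0))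
  | nil {V : Env} {n : ℕ} : Step V .nil (n + 1) (PMF.pure (some .nil, 0))
  | cons {V : Env} {n : ℕ} {x₁ x₂ : Var} :
      Step V (.cons x₁ x₂) (n + 1) (PMF.pure (some (.cons (V x₁) (V x₂)), 0))
  | matL_nil {V : Env} {n : ℕ} {x x₁ x₂ : Var} {e₀ e₁ : Expr} {μ : PMF Outcome}
      (hx : V x = .nil) (h : Step V e₀ n μ) : Step V (.matL x e₀ x₁ x₂ e₁) (n + 1) μ
  | matL_cons {V : Env} {n : ℕ} {x x₁ x₂ : Var} {e₀ e₁ : Expr} {v₁ v₂ : Val} {μ : PMF Outcome}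
      (hx : V x = .cons v₁ v₂)
      (h : Step (Function.update (Function.update V x₁ v₁) x₂ v₂) e₁ n μ) :
      Step V (.matL x e₀ x₁ x₂ e₁) (n + 1) μ
  | tick {V : Env} {n : ℕ} {q : ℚ≥0} :
      Step V (.tick q) (n + 1) (PMF.pure (some .triv, (q : Cost)))
  | fn {V : Env} {n : ℕ} {f x : Var} {e : Expr} :
      Step V (.fn f x e) (n + 1) (PMF.pure (some (.clo V f x e), 0))
  | app {V V' : Env} {n : ℕ} {x₁ x₂ f x : Var} {e : Expr} {μ : PMF Outcome}
      (hx : V x₁ = .clo V' f x e)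
      (h : Step (Function.update (Function.update V' f (.clo V' f x e)) x (V x₂)) e n μ) :
      Step V (.app x₁ x₂) (n + 1) μ
  | letE {V : Env} {n : ℕ} {x : Var} {e₁ e₂ : Expr} {μ : PMF Outcome}
      {κ : Val → Cost → PMF Outcome} (h₁ : Step V e₁ n μ)
      (h₂ : ∀ v₁ q₁, μ (some v₁, q₁) ≠ 0 → Step (Function.update V x v₁) e₂ n (κ v₁ q₁)) :
      Step V (.letE e₁ x e₂) (n + 1) (seqDist μ κ)
  | share {V : Env} {n : ℕ} {x x₁ x₂ : Var} {e : Expr} {μ : PMF Outcome}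
      (h : Step (Function.update (Function.update V x₁ (V x)) x₂ (V x)) e n μ) :
      Step V (.share x x₁ x₂ e) (n + 1) μ
  | flip {V : Env} {n : ℕ} {p : Prob} {e₁ e₂ : Expr} {μ₁ μ₂ : PMF Outcome}
      (h₁ : Step V e₁ n μ₁) (h₂ : Step V e₂ n μ₂) :
      Step V (.flip p e₁ e₂) (n + 1) (mix p μ₁ μ₂)
  | prob {V : Env} {n : ℕ} {p : Prob} :
      Step V (.prob p) (n + 1) (PMF.pure (some (.prob p), 0))
  | flipS {V : Env} {n : ℕ} {x : Var} {p : Prob} {e₁ e₂ : Expr} {μ₁ μ₂ : PMF Outcome}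
      (hx : V x = .prob p) (h₁ : Step V e₁ n μ₁) (h₂ : Step V e₂ n μ₂) :
      Step V (.flipS x e₁ e₂) (n + 1) (mix p μ₁ μ₂)

/-- The order `μ₁ ⊑ μ₂` on full distributions. -/
def DistLE (μ₁ μ₂ : PMF Outcome) : Prop :=
  (∀ (v : Val) (q : Cost), μ₁ (some v, q) ≤ μ₂ (some v, q)) ∧
  ∀ q : Cost, μ₂.toOuterMeasure {o | o.2 ≤ q} ≤ μ₁.toOuterMeasure {o | o.2 ≤ q}

/-- `μ` is the full distribution `⟦e⟧` of the terminating and non-terminating executions of `e`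
in the environment `V`: the expression `e` reduces in `V` to some `μₙ` at every depth `n`, these
distributions form a `⊑`-chain, and `μ` is a least upper bound of the chain. -/
def IsFullDist (V : Env) (e : Expr) (μ : PMF Outcome) : Prop :=
  ∃ μs : ℕ → PMF Outcome,
    (∀ n, Step V e n (μs n)) ∧
    (∀ n, DistLE (μs n) (μs (n + 1))) ∧
    (∀ n, DistLE (μs n) μ) ∧
    ∀ ν : PMF Outcome, (∀ n, DistLE (μs n) ν) → DistLE μ ν

/-! ### Sanity facts -/

/-- Only contexts with a finite domain occur in derivable judgments. -/
theorem Typing.finite_dom {Γ : Ctx} {q : ℚ≥0} {e : Expr} {A : PTy} (h : Typing Γ q e A) :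
    {x | Γ x ≠ none}.Finite := by
  have ext_fin : ∀ (Γ : Ctx) (x : Var) (τ : Ty), {y | Γ y ≠ none}.Finite →
      {y | Γ.ext x τ y ≠ none}.Finite := by
    intro Γ x τ h
    refine (h.insert x).subset fun y hy => ?_
    by_cases hxy : y = x
    · exact Or.inl hxy
    · exact Or.inr (by simpa [Ctx.ext, Function.update_of_ne hxy] using hy)
  have unext_fin : ∀ (Γ : Ctx) (x : Var) (τ : Ty), {y | Γ.ext x τ y ≠ none}.Finite →
      {y | Γ y ≠ none}.Finite := by
    intro Γ x τ h
    refine (h.insert x).subset fun y hy => ?_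
    by_cases hxy : y = x
    · exact Or.inl hxy
    · exact Or.inr (by simpa [Ctx.ext, Function.update_of_ne hxy] using hy)
  have empty_fin : {y | Ctx.empty y ≠ none}.Finite := by simp [Ctx.empty]
  induction h with
  | var => exact ext_fin _ _ _ empty_fin
  | triv => exact empty_fin
  | nil => exact empty_fin
  | cons _ => exact ext_fin _ _ _ (ext_fin _ _ _ empty_fin)
  | matL _ _ _ ih _ => exact ext_fin _ _ _ ih
  | tick => exact empty_fin
  | letE _ _ _ ih₁ ih₂ =>
    refine (ih₁.union (unext_fin _ _ _ ih₂)).subset fun y hy => ?_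
    simp only [Ctx.join, Set.mem_ofPred_eq, Set.mem_union] at hy ⊢
    by_contra hc
    push Not at hc
    exact hy (by simp [hc.1, hc.2])
  | app _ => exact ext_fin _ _ _ (ext_fin _ _ _ empty_fin)
  | fn _ _ ih => exact unext_fin _ _ _ (unext_fin _ _ _ ih)
  | share _ _ _ ih => exact ext_fin _ _ _ (unext_fin _ _ _ (unext_fin _ _ _ ih))
  | flip hΓ _ _ _ ih _ =>
    refine ih.subset fun y hy => ?_
    rcases hΓ y with ⟨h, _⟩ | ⟨_, _, _, _, h, _⟩
    · exact absurd h hy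
    · intro hc
      simp [Ctx.scale, hc] at h
  | prob _ => exact empty_fin
  | flipS _ _ _ ih _ => exact ext_fin _ _ _ ih
  | sub _ _ ih => exact ih
  | sup _ _ ih => exact ext_fin _ _ _ (unext_fin _ _ _ ih)
  | weak _ _ ih => exact ext_fin _ _ _ ih
  | relax _ _ _ ih => exact ih

/-- The potential of a well-typed value is meaningful. -/
theorem HasType.fits {v : Val} {τ : Ty} (h : HasType v τ) : v.Fits τ := by
  induction h with
  | cons _ _ ih₁ ih₂ => exact ⟨ih₁, ih₂⟩
  | _ => trivial

end AARA

/-!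
The proof bounds, for every evaluation depth `n`, the expected charge (cost plus potential of the
result) of the distribution `μₙ` with `V ⊢ e ⇒ₙ μₙ`, and then passes to the limit.

*Fixed depth* (`Typing.exists_step`). Induction on `n`, and for fixed `n` on the typing derivation,
because the structural rules do not use up depth. For `let`, the charge of the result of the first
expression pays for the second one; for `flip`, the sharing relation splits the potential of the
environment in the proportions of the mixture. The induction also shows that the `μₙ` exist, which
needs that results are well-typed. The declared typing of closures is not closed under subtyping,
so the induction uses the larger relation `GridTyped`.

*Existence of the limit* (`exists_sup_of_chain`). The rational numbers are not complete, so the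
costs of partial evaluations might a priori converge to an irrational number, and the chain would
have no least upper bound. This cannot happen: only finitely many `tick` constants matter for `e`
and the values that `V` assigns to its variables, hence for some `N > 0` all costs are multiples of
`1 / N`. This grid is also tracked by `GridTyped`. On a grid, the least upper bound is the
distribution whose tail probabilities `P(cost > c)`, and whose probabilities of terminating
outcomes, are the suprema of those of the `μₙ`.

*Passing to the limit* (`expect_charge_sup_le`). A cost on the grid is the sum of the grid steps
below it, so the expected charge is a sum, with nonnegative coefficients, of tail probabilities and
of probabilities of terminating outcomes. These increase along the chain, so monotone convergence
applies. The semantics is deterministic (`Step.unique`) and the order on distributions is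
antisymmetric (`DistLE.antisymm`), so the limit constructed here is the only full distribution.
-/

namespace AARA

open Function Set

/-! ### Expectations under discrete distributions -/

section Expectation

variable {α β : Type}

/-- The expectation of a weight function `w` with values in `[0, ∞]` under `μ`. -/
noncomputable def expect (μ : PMF α) (w : α → ℝ≥0∞) : ℝ≥0∞ := ∑' a, μ a * w a

theorem expect_mono {μ : PMF α} {w w' : α → ℝ≥0∞} (h : ∀ a, μ a ≠ 0 → w a ≤ w' a) :
    expect μ w ≤ expect μ w' := by
  refine ENNReal.tsum_le_tsum fun a => ?_
  by_cases ha : μ a = 0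
  · simp [ha]
  · exact mul_le_mul_right (h a ha) _

theorem expect_congr {μ : PMF α} {w w' : α → ℝ≥0∞} (h : ∀ a, μ a ≠ 0 → w a = w' a) :
    expect μ w = expect μ w' :=
  le_antisymm (expect_mono fun a ha => (h a ha).le) (expect_mono fun a ha => (h a ha).ge)

theorem expect_add (μ : PMF α) (w w' : α → ℝ≥0∞) :
    expect μ (fun a => w a + w' a) = expect μ w + expect μ w' := by
  simp only [expect, mul_add, ENNReal.tsum_add]

theorem expect_tsum (μ : PMF α) {ι : Type} (w : ι → α → ℝ≥0∞) :
    expect μ (fun a => ∑' i, w i a) = ∑' i, expect μ (w i) := by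
  simp only [expect, ← ENNReal.tsum_mul_left]
  exact ENNReal.tsum_comm

theorem expect_const_mul (μ : PMF α) (r : ℝ≥0∞) (w : α → ℝ≥0∞) :
    expect μ (fun a => r * w a) = r * expect μ w := by
  simp only [expect, ← ENNReal.tsum_mul_left, mul_left_comm]

theorem expect_const (μ : PMF α) (r : ℝ≥0∞) : expect μ (fun _ => r) = r := by
  simp [expect, ENNReal.tsum_mul_right, μ.tsum_coe]

theorem expect_pure (a : α) (w : α → ℝ≥0∞) : expect (PMF.pure a) w = w a := by
  classical
  rw [expect, tsum_eq_single a]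
  · simp
  · intro b hb
    simp [PMF.pure_apply, hb]

theorem expect_bind (μ : PMF α) (κ : α → PMF β) (w : β → ℝ≥0∞) :
    expect (μ.bind κ) w = expect μ fun a => expect (κ a) w := by
  simp only [expect, PMF.bind_apply, ← ENNReal.tsum_mul_right, ← ENNReal.tsum_mul_left, mul_assoc]
  exact ENNReal.tsum_comm

theorem expect_map (μ : PMF α) (f : α → β) (w : β → ℝ≥0∞) :
    expect (μ.map f) w = expect μ fun a => w (f a) := by
  simp only [PMF.map, expect_bind, comp_apply, expect_pure]

theorem mix_apply (p : Prob) (μ₁ μ₂ : PMF α) (a : α) :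
    mix p μ₁ μ₂ a = ratToENNReal p.1 * μ₁ a + ratToENNReal p.compl.1 * μ₂ a := rfl

theorem expect_mix (p : Prob) (μ₁ μ₂ : PMF α) (w : α → ℝ≥0∞) :
    expect (mix p μ₁ μ₂) w =
      ratToENNReal p.1 * expect μ₁ w + ratToENNReal p.compl.1 * expect μ₂ w := by
  simp only [expect, mix_apply, add_mul, ENNReal.tsum_add, ← ENNReal.tsum_mul_left, mul_assoc]

theorem apply_eq_expect [DecidableEq α] (μ : PMF α) (a : α) :
    μ a = expect μ fun b => if b = a then 1 else 0 := by
  rw [expect, tsum_eq_single a]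
  · simp
  · intro b hb
    simp [hb]

end Expectation

/-- The weight that sequential composition with `κ` assigns to the outcome of the first
expression: `w` itself after a partial evaluation, the expectation of `w` with the cost shifted
otherwise. -/
noncomputable def seqWeight (κ : Val → Cost → PMF Outcome) (w : Outcome → ℝ≥0∞) :
    Outcome → ℝ≥0∞
  | (none, q₁) => w (none, q₁)
  | (some v₁, q₁) => expect (κ v₁ q₁) fun o => w (o.1, q₁ + o.2)

theorem expect_seqDist (μ : PMF Outcome) (κ : Val → Cost → PMF Outcome) (w : Outcome → ℝ≥0∞) :
    expect (seqDist μ κ) w = expect μ (seqWeight κ w) := by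
  rw [seqDist, expect_bind]
  refine expect_congr fun o _ => ?_
  rcases o with ⟨_ | v, q⟩
  · simp [seqWeight, expect_pure]
  · simp [seqWeight, expect_map]

/-! ### The order on full distributions in terms of tail probabilities -/

open scoped Classical in
/-- The probability that the cost exceeds `c`. -/
noncomputable def tail (μ : PMF Outcome) (c : Cost) : ℝ≥0∞ :=
  expect μ fun o => if c < o.2 then 1 else 0

theorem tail_top (μ : PMF Outcome) : tail μ ⊤ = 0 := by simp [tail, expect_const]

theorem toOuterMeasure_add_tail (μ : PMF Outcome) (c : Cost) :
    μ.toOuterMeasure {o | o.2 ≤ c} + tail μ c = 1 := by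
  classical
  rw [PMF.toOuterMeasure_apply, tail, expect, ← ENNReal.tsum_add, ← μ.tsum_coe]
  refine tsum_congr fun o => ?_
  by_cases h : o.2 ≤ c
  · simp [h, not_lt.2 h]
  · simp [h, not_le.1 h]

theorem distLE_iff {μ ν : PMF Outcome} :
    DistLE μ ν ↔ (∀ v c, μ (some v, c) ≤ ν (some v, c)) ∧ ∀ c, tail μ c ≤ tail ν c := by
  have key : ∀ a b s t : ℝ≥0∞, a + s = 1 → b + t = 1 → s ≤ t → b ≤ a := by
    intro a b s t ha hb hst
    have hs : s ≠ ∞ := by rintro rfl; simp at ha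
    refine (ENNReal.add_le_add_iff_right hs).1 ?_
    rw [ha, ← hb]
    gcongr
  refine and_congr Iff.rfl (forall_congr' fun c => ⟨fun h => ?_, fun h => ?_⟩)
  · refine key _ _ _ _ ?_ ?_ h <;> rw [add_comm] <;> exact toOuterMeasure_add_tail _ c
  · exact key _ _ _ _ (toOuterMeasure_add_tail μ c) (toOuterMeasure_add_tail ν c) h

theorem DistLE.tail_le {μ ν : PMF Outcome} (h : DistLE μ ν) (c : Cost) : tail μ c ≤ tail ν c :=
  (distLE_iff.1 h).2 c

theorem DistLE.rfl {μ : PMF Outcome} : DistLE μ μ := ⟨fun _ _ => le_rfl, fun _ => le_rfl⟩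

/-- The order is antisymmetric. The mass at cost `c` is determined by the distribution function,
because `{cost < c}` is the countable union of the sets `{cost ≤ r}` for `r < c`; subtracting the
mass of the terminating outcomes leaves that of the partial evaluation with cost `c`. -/
theorem DistLE.antisymm {μ ν : PMF Outcome} (h : DistLE μ ν) (h' : DistLE ν μ) : μ = ν := by
  let m : MeasurableSpace Outcome := ⊤
  have hms : ∀ s : Set Outcome, MeasurableSet s := fun _ => trivial
  have hval : ∀ v c, μ (some v, c) = ν (some v, c) := fun v c => le_antisymm (h.1 v c) (h'.1 v c)
  have hle : ∀ c : Cost, μ.toMeasure {o | o.2 ≤ c} = ν.toMeasure {o | o.2 ≤ c} := fun c => by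
    rw [PMF.toMeasure_apply_eq_toOuterMeasure_apply _ (hms _),
      PMF.toMeasure_apply_eq_toOuterMeasure_apply _ (hms _)]
    exact le_antisymm (h'.2 c) (h.2 c)
  have hlt : ∀ c : Cost, μ.toMeasure {o | o.2 < c} = ν.toMeasure {o | o.2 < c} := fun c => by
    have hU : {o : Outcome | o.2 < c} = ⋃ r : {r : Cost // r < c}, {o | o.2 ≤ r.1} := by
      ext o
      simp only [mem_ofPred_eq, mem_iUnion]
      exact ⟨fun ho => ⟨⟨o.2, ho⟩, le_rfl⟩, fun ⟨r, hr⟩ => hr.trans_lt r.2⟩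
    have hd : Directed (· ⊆ ·) fun r : {r : Cost // r < c} => {o : Outcome | o.2 ≤ r.1} :=
      directed_of_isDirected_le fun r s hrs o (ho : o.2 ≤ r.1) => ho.trans hrs
    have : Countable Cost := inferInstanceAs (Countable (Option ℚ≥0))
    rw [hU, hd.measure_iUnion, hd.measure_iUnion]
    simp only [hle]
  have hsplit : ∀ (ρ : PMF Outcome) (c : Cost), ρ.toMeasure {o | o.2 ≤ c} =
      ρ.toMeasure {o | o.2 < c} + (ρ.toMeasure {o | o.2 = c ∧ o.1 ≠ none} + ρ (none, c)) := by
    intro ρ c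
    have hs : ρ (none, c) = ρ.toMeasure {(none, c)} := by
      rw [PMF.toMeasure_apply_singleton _ _ (hms _)]
    rw [hs, ← MeasureTheory.measure_union _ (hms _), ← MeasureTheory.measure_union _ (hms _)]
    · congr 1
      ext ⟨o, d⟩
      simp only [mem_ofPred_eq, mem_union, mem_singleton_iff, Prod.mk.injEq, le_iff_lt_or_eq]
      tauto
    · rw [Set.disjoint_left]
      rintro o ho (⟨h1, -⟩ | rfl)
      · exact ho.ne h1
      · exact lt_irrefl c ho
    · rw [Set.disjoint_left]
      rintro o ⟨-, ho⟩ rfl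
      exact ho _root_.rfl
  have hsome : ∀ c : Cost, μ.toMeasure {o | o.2 = c ∧ o.1 ≠ none} =
      ν.toMeasure {o | o.2 = c ∧ o.1 ≠ none} := fun c => by
    rw [PMF.toMeasure_apply _ (hms _), PMF.toMeasure_apply _ (hms _)]
    refine tsum_congr fun o => ?_
    rcases o with ⟨_ | v, d⟩
    · simp
    · classical
      simp only [indicator_apply, hval]
  ext ⟨o, c⟩
  rcases o with _ | v
  · have hc := hle c
    rw [hsplit μ c, hsplit ν c, hlt, hsome, ENNReal.add_right_inj (MeasureTheory.measure_ne_top _ _),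
      ENNReal.add_right_inj (MeasureTheory.measure_ne_top _ _)] at hc
    exact hc
  · exact hval v c

theorem distLE_pure_none (μ : PMF Outcome) : DistLE (PMF.pure (none, 0)) μ := by
  classical
  refine distLE_iff.2 ⟨fun v c => by simp [PMF.pure_apply], fun c => ?_⟩
  simp [tail, expect_pure]

theorem DistLE.mix {p : Prob} {μ₁ μ₂ ν₁ ν₂ : PMF Outcome} (h₁ : DistLE μ₁ ν₁)
    (h₂ : DistLE μ₂ ν₂) : DistLE (mix p μ₁ μ₂) (mix p ν₁ ν₂) := by
  refine distLE_iff.2 ⟨fun v c => ?_, fun c => ?_⟩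
  · simp only [mix_apply]
    gcongr
    exacts [h₁.1 v c, h₂.1 v c]
  · simp only [tail, expect_mix]
    gcongr
    exacts [h₁.tail_le c, h₂.tail_le c]

/-- If a weight vanishes on partial evaluations and grows pointwise on the support of the smaller
distribution, its expectation is monotone along `⊑`. -/
theorem DistLE.expect_le {μ ν : PMF Outcome} (h : DistLE μ ν) {w w' : Outcome → ℝ≥0∞}
    (hw : ∀ c, w (none, c) = 0) (hww : ∀ v c, μ (some v, c) ≠ 0 → w (some v, c) ≤ w' (some v, c)) :
    expect μ w ≤ expect ν w' := by
  refine ENNReal.tsum_le_tsum fun o => ?_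
  rcases o with ⟨_ | v, c⟩
  · simp [hw]
  · by_cases h0 : μ (some v, c) = 0
    · simp [h0]
    · exact mul_le_mul' (h.1 v c) (hww v c h0)

open scoped Classical in
/-- The probability that a second expression, with outcome distribution `κ v₁ q₁`, makes the total
cost exceed `c`, counted only if the cost `q₁` of the first one does not. No cost exceeds `⊤`, which
has to be said separately because `⊤ - ⊤ = 0` for costs. -/
noncomputable def lateExcess (κ : Val → Cost → PMF Outcome) (c : Cost) : Outcome → ℝ≥0∞
  | (none, _) => 0
  | (some v₁, q₁) => if c < q₁ ∨ c = ⊤ then 0 else tail (κ v₁ q₁) (c - q₁)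

/-- In this form the tail of a sequential composition is visibly monotone in both arguments. -/
theorem tail_seqDist (μ : PMF Outcome) (κ : Val → Cost → PMF Outcome) (c : Cost) :
    tail (seqDist μ κ) c = tail μ c + expect μ (lateExcess κ c) := by
  classical
  rw [tail, expect_seqDist, tail, ← expect_add]
  refine expect_congr fun o _ => ?_
  rcases o with ⟨_ | v, q⟩
  · simp [seqWeight, lateExcess]
  · by_cases hq : c < q
    · have : ∀ d : Cost, c < q + d := fun d => hq.trans_le le_self_add
      simp [seqWeight, lateExcess, hq, this, expect_const]
    rcases eq_or_ne c ⊤ with rfl | hct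
    · simp [seqWeight, lateExcess, expect_const]
    have hq' : q ≤ c := not_lt.1 hq
    have : ∀ d : Cost, c < q + d ↔ c - q < d := fun d => by
      lift q to ℚ≥0 using ne_top_of_le_ne_top hct hq'
      lift c to ℚ≥0 using hct
      rcases eq_or_ne d ⊤ with rfl | hdt
      · simp [← WithTop.coe_sub]
      · lift d to ℚ≥0 using hdt
        norm_cast at hq' ⊢
        exact (tsub_lt_iff_left hq').symm
    simp [seqWeight, lateExcess, hq, hct, this, tail]

theorem DistLE.seqDist {μ ν : PMF Outcome} {κ κ' : Val → Cost → PMF Outcome} (h : DistLE μ ν)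
    (hκ : ∀ v c, μ (some v, c) ≠ 0 → DistLE (κ v c) (κ' v c)) :
    DistLE (seqDist μ κ) (seqDist ν κ') := by
  classical
  refine distLE_iff.2 ⟨fun v c => ?_, fun c => ?_⟩
  · rw [apply_eq_expect, apply_eq_expect, expect_seqDist, expect_seqDist]
    refine h.expect_le (by simp [seqWeight]) fun v₁ q₁ h₁ => ?_
    exact (hκ v₁ q₁ h₁).expect_le (by simp) fun _ _ _ => le_rfl
  · rw [tail_seqDist, tail_seqDist]
    refine add_le_add (h.tail_le c) (h.expect_le (by simp [lateExcess]) fun v₁ q₁ h₁ => ?_)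
    simp only [lateExcess]
    split_ifs
    · exact le_rfl
    · exact (hκ v₁ q₁ h₁).tail_le _

theorem seqDist_congr {μ : PMF Outcome} {κ κ' : Val → Cost → PMF Outcome}
    (h : ∀ v c, μ (some v, c) ≠ 0 → κ v c = κ' v c) : seqDist μ κ = seqDist μ κ' :=
  DistLE.antisymm (DistLE.rfl.seqDist fun v c hv => h v c hv ▸ DistLE.rfl)
    (DistLE.rfl.seqDist fun v c hv => h v c hv ▸ DistLE.rfl)

theorem seqDist_ne_zero {μ : PMF Outcome} {κ : Val → Cost → PMF Outcome} {o : Outcome}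
    (h : seqDist μ κ o ≠ 0) :
    (o.1 = none ∧ μ o ≠ 0) ∨
      ∃ v₁ q₁ o₂, μ (some v₁, q₁) ≠ 0 ∧ κ v₁ q₁ o₂ ≠ 0 ∧ o = (o₂.1, q₁ + o₂.2) := by
  rw [← PMF.mem_support_iff, seqDist, PMF.mem_support_bind_iff] at h
  obtain ⟨⟨_ | v, q⟩, hμ, ho⟩ := h
  · left
    have ho' : o = (none, q) := by simpa using ho
    subst ho'
    exact ⟨_root_.rfl, hμ⟩
  · right
    obtain ⟨o₂, h₂, rfl⟩ := (PMF.mem_support_map_iff _ _ _).1 ho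
    exact ⟨v, q, o₂, hμ, h₂, _root_.rfl⟩

/-! ### The semantics is deterministic and monotone in the depth -/

theorem Step.unique {V : Env} {e : Expr} {n : ℕ} {μ ν : PMF Outcome} (h : Step V e n μ)
    (h' : Step V e n ν) : μ = ν := by
  induction h generalizing ν with
  | letE h₁ h₂ ih₁ ih₂ =>
    cases h' with
    | letE h₁' h₂' =>
      obtain rfl := ih₁ h₁'
      exact seqDist_congr fun v c hv => ih₂ v c hv (h₂' v c hv)
  | flip h₁ h₂ ih₁ ih₂ =>
    cases h' with
    | flip h₁' h₂' => rw [ih₁ h₁', ih₂ h₂']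
  | flipS hx h₁ h₂ ih₁ ih₂ =>
    cases h' with
    | flipS hx' h₁' h₂' =>
      obtain rfl : _ = _ := by simpa [hx] using hx'
      rw [ih₁ h₁', ih₂ h₂']
  | matL_nil hx h ih =>
    cases h' with
    | matL_nil hx' h' => exact ih h'
    | matL_cons hx' h' => simp [hx] at hx'
  | matL_cons hx h ih =>
    cases h' with
    | matL_nil hx' h' => simp [hx] at hx'
    | matL_cons hx' h' =>
      obtain ⟨rfl, rfl⟩ : _ ∧ _ := by simpa [hx] using hx'
      exact ih h'
  | app hx h ih =>
    cases h' with
    | app hx' h' =>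
      obtain ⟨rfl, rfl, rfl, rfl⟩ : _ ∧ _ ∧ _ ∧ _ := by simpa [hx] using hx'
      exact ih h'
  | share h ih =>
    cases h' with
    | share h' => exact ih h'
  | _ => cases h'; rfl

theorem Step.distLE {V : Env} {e : Expr} {n : ℕ} {μ ν : PMF Outcome} (h : Step V e n μ)
    (h' : Step V e (n + 1) ν) : DistLE μ ν := by
  induction h generalizing ν with
  | base => exact distLE_pure_none ν
  | letE h₁ h₂ ih₁ ih₂ =>
    cases h' with
    | letE h₁' h₂' =>
      have h := ih₁ h₁'
      refine h.seqDist fun v c hv => ih₂ v c hv (h₂' v c ?_)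
      exact fun h0 => hv (le_zero_iff.1 (h0 ▸ h.1 v c))
  | flip h₁ h₂ ih₁ ih₂ =>
    cases h' with
    | flip h₁' h₂' => exact (ih₁ h₁').mix (ih₂ h₂')
  | flipS hx h₁ h₂ ih₁ ih₂ =>
    cases h' with
    | flipS hx' h₁' h₂' =>
      obtain rfl : _ = _ := by simpa [hx] using hx'
      exact (ih₁ h₁').mix (ih₂ h₂')
  | matL_nil hx h ih =>
    cases h' with
    | matL_nil hx' h' => exact ih h'
    | matL_cons hx' h' => simp [hx] at hx'
  | matL_cons hx h ih =>
    cases h' with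
    | matL_nil hx' h' => simp [hx] at hx'
    | matL_cons hx' h' =>
      obtain ⟨rfl, rfl⟩ : _ ∧ _ := by simpa [hx] using hx'
      exact ih h'
  | app hx h ih =>
    cases h' with
    | app hx' h' =>
      obtain ⟨rfl, rfl, rfl, rfl⟩ : _ ∧ _ ∧ _ ∧ _ := by simpa [hx] using hx'
      exact ih h'
  | share h ih =>
    cases h' with
    | share h' => exact ih h'
  | _ => cases h'; exact DistLE.rfl

/-! ### Potentials and costs in `[0, ∞]` -/

@[simp] theorem ratToENNReal_zero : ratToENNReal 0 = 0 := by simp [ratToENNReal]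

theorem ratToENNReal_add (a b : ℚ≥0) :
    ratToENNReal (a + b) = ratToENNReal a + ratToENNReal b := by
  simp [ratToENNReal]

theorem ratToENNReal_mul (a b : ℚ≥0) :
    ratToENNReal (a * b) = ratToENNReal a * ratToENNReal b := by
  simp [ratToENNReal]

theorem ratToENNReal_mono {a b : ℚ≥0} (h : a ≤ b) : ratToENNReal a ≤ ratToENNReal b := by
  unfold ratToENNReal
  exact_mod_cast h

theorem ratToENNReal_prob_add_compl (p : Prob) :
    ratToENNReal p.1 + ratToENNReal p.compl.1 = 1 := by
  rw [← ratToENNReal_add, Prob.compl, add_tsub_cancel_of_le p.2]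
  simp [ratToENNReal]

@[simp] theorem Cost.toENNReal_coe (q : ℚ≥0) : Cost.toENNReal (q : Cost) = ratToENNReal q := rfl

@[simp] theorem Cost.toENNReal_zero : Cost.toENNReal 0 = 0 := ratToENNReal_zero

theorem Cost.toENNReal_add (a b : Cost) :
    Cost.toENNReal (a + b) = Cost.toENNReal a + Cost.toENNReal b := by
  rcases eq_or_ne a ⊤ with rfl | ha
  · simp [Cost.toENNReal]
  rcases eq_or_ne b ⊤ with rfl | hb
  · simp [Cost.toENNReal]
  lift a to ℚ≥0 using ha
  lift b to ℚ≥0 using hb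
  exact ratToENNReal_add a b

/-- The summand of `Φ(V : Γ)` at the variable `x`. -/
noncomputable def Env.potentialAt (V : Env) (Γ : Ctx) (x : Var) : ℝ≥0∞ :=
  match Γ x with
  | some τ => ratToENNReal ((V x).potential τ)
  | none => 0

theorem Env.potential_eq (V : Env) (Γ : Ctx) : V.potential Γ = ∑' x, V.potentialAt Γ x := rfl

theorem Env.potentialAt_some {V : Env} {Γ : Ctx} {x : Var} {τ : Ty} (h : Γ x = some τ) :
    V.potentialAt Γ x = ratToENNReal ((V x).potential τ) := by
  simp [Env.potentialAt, h]

theorem Env.potentialAt_none {V : Env} {Γ : Ctx} {x : Var} (h : Γ x = none) :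
    V.potentialAt Γ x = 0 := by
  simp [Env.potentialAt, h]

theorem Ctx.ext_self (Γ : Ctx) (x : Var) (τ : Ty) : Γ.ext x τ x = some τ := by simp [Ctx.ext]

theorem Ctx.ext_of_ne (Γ : Ctx) {x y : Var} (τ : Ty) (h : y ≠ x) : Γ.ext x τ y = Γ y := by
  simp [Ctx.ext, h]

theorem Env.potential_update_ext_le (V : Env) (Γ : Ctx) (x : Var) (v : Val) (τ : Ty) :
    Env.potential (update V x v) (Γ.ext x τ) ≤ V.potential Γ + ratToENNReal (v.potential τ) := by
  rw [Env.potential_eq, ENNReal.tsum_eq_add_tsum_ite x, add_comm, Env.potential_eq,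
    Env.potentialAt_some (Γ.ext_self x τ), update_self]
  gcongr with y
  split_ifs with hy
  · exact zero_le
  · simp [Env.potentialAt, Ctx.ext_of_ne _ _ hy, update_of_ne hy]

theorem Env.potential_ext (V : Env) {Γ : Ctx} {x : Var} (τ : Ty) (hx : Γ x = none) :
    V.potential (Γ.ext x τ) = V.potential Γ + ratToENNReal ((V x).potential τ) := by
  rw [Env.potential_eq, ENNReal.tsum_eq_add_tsum_ite x, add_comm, Env.potential_eq,
    Env.potentialAt_some (Γ.ext_self x τ)]
  congr 1
  refine tsum_congr fun y => ?_
  split_ifs with hy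
  · rw [hy, Env.potentialAt_none hx]
  · simp [Env.potentialAt, Ctx.ext_of_ne _ _ hy]

theorem Env.potential_join (V : Env) {Γ₁ Γ₂ : Ctx} (h : Γ₁.Disj Γ₂) :
    V.potential (Γ₁.join Γ₂) = V.potential Γ₁ + V.potential Γ₂ := by
  simp only [Env.potential_eq, ← ENNReal.tsum_add]
  refine tsum_congr fun x => ?_
  rcases h x with h | h
  · simp [Env.potentialAt, Ctx.join, h]
  · simp [Env.potentialAt, Ctx.join, h]

theorem potential_zero (v : Val) (τ : Ty) : v.potential τ.zero = 0 := by
  induction v generalizing τ with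
  | cons v₁ v₂ ih₁ ih₂ =>
    cases τ with
    | list τ q =>
      have h := ih₂ (.list τ q)
      simp only [Ty.zero] at h
      simp [Ty.zero, Val.potential, ih₁, h]
    | _ => rfl
  | _ => cases τ <;> simp [Ty.zero, Val.potential]

theorem potential_scale (p : ℚ≥0) (v : Val) (τ : Ty) :
    v.potential (τ.scale p) = p * v.potential τ := by
  induction v generalizing τ with
  | cons v₁ v₂ ih₁ ih₂ =>
    cases τ with
    | list τ q =>
      have h := ih₂ (.list τ q)
      simp only [Ty.scale] at h
      simp only [Ty.scale, Val.potential, ih₁, h]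
      ring
    | _ => simp [Ty.scale, Val.potential]
  | prob r =>
    cases τ with
    | prob qH qT =>
      simp only [Ty.scale, Val.potential]
      ring
    | _ => simp [Ty.scale, Val.potential]
  | _ => cases τ <;> simp [Ty.scale, Val.potential]

theorem Share.potential {τ τ₁ τ₂ : Ty} (h : Share τ τ₁ τ₂) (v : Val) :
    v.potential τ = v.potential τ₁ + v.potential τ₂ := by
  induction v generalizing τ τ₁ τ₂ with
  | cons v₁ v₂ ih₁ ih₂ =>
    cases h with
    | list hq hτ =>
      have h := ih₂ (.list hq hτ)
      simp only [Val.potential, ih₁ hτ, h]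
      rw [hq]
      ring
    | _ => simp [Val.potential]
  | prob r =>
    cases h with
    | prob hH hT =>
      simp only [Val.potential, hH, hT]
      ring
    | _ => simp [Val.potential]
  | _ => cases h <;> simp [Val.potential]

theorem SubTy.potential_le {τ τ' : Ty} (h : SubTy τ τ') (v : Val) :
    v.potential τ' ≤ v.potential τ := by
  induction v generalizing τ τ' with
  | cons v₁ v₂ ih₁ ih₂ =>
    cases h with
    | list hτ hq =>
      simp only [Val.potential]
      gcongr
      exacts [ih₁ hτ, ih₂ (.list hτ hq)]
    | _ => simp [Val.potential]
  | prob r =>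
    cases h with
    | prob hH hT =>
      simp only [Val.potential]
      gcongr
    | _ => simp [Val.potential]
  | _ => cases h <;> simp [Val.potential]

theorem Env.potential_ext_le_of_subTy (V : Env) (Γ : Ctx) (x : Var) {τ τ' : Ty}
    (h : SubTy τ' τ) : V.potential (Γ.ext x τ) ≤ V.potential (Γ.ext x τ') := by
  refine ENNReal.tsum_le_tsum fun y => ?_
  change V.potentialAt _ y ≤ V.potentialAt _ y
  by_cases hy : y = x
  · subst hy
    rw [Env.potentialAt_some (Γ.ext_self y τ), Env.potentialAt_some (Γ.ext_self y τ')]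
    exact ratToENNReal_mono (h.potential_le _)
  · simp [Env.potentialAt, Ctx.ext_of_ne _ _ hy]

theorem Env.potential_zero (V : Env) (Γ : Ctx) : V.potential Γ.zero = 0 := by
  rw [Env.potential_eq, ENNReal.tsum_eq_zero]
  intro x
  cases h : Γ x <;> simp [Env.potentialAt, Ctx.zero, h, AARA.potential_zero]

theorem Env.potential_share_scale (V : Env) {Γ Γ₁ Γ₂ : Ctx} {p₁ p₂ : ℚ≥0}
    (h : Γ.Share (Γ₁.scale p₁) (Γ₂.scale p₂)) :
    V.potential Γ =
      ratToENNReal p₁ * V.potential Γ₁ + ratToENNReal p₂ * V.potential Γ₂ := by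
  simp only [Env.potential_eq, ← ENNReal.tsum_mul_left, ← ENNReal.tsum_add]
  refine tsum_congr fun x => ?_
  rcases h x with ⟨h0, h1, h2⟩ | ⟨τ, τ₁, τ₂, h0, h1, h2, hs⟩
  · simp only [Ctx.scale, Option.map_eq_none_iff] at h1 h2
    simp [Env.potentialAt, h0, h1, h2]
  · simp only [Ctx.scale, Option.map_eq_some_iff] at h1 h2
    obtain ⟨σ₁, h1, rfl⟩ := h1
    obtain ⟨σ₂, h2, rfl⟩ := h2
    rw [Env.potentialAt_some h0, Env.potentialAt_some h1, Env.potentialAt_some h2,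
      hs.potential, potential_scale, potential_scale, ratToENNReal_add, ratToENNReal_mul,
      ratToENNReal_mul]

/-! ### Types up to annotations, and subtyping -/

theorem Ty.zero_zero (τ : Ty) : τ.zero.zero = τ.zero := by
  induction τ with
  | list τ q ih => simp [Ty.zero, ih]
  | _ => simp [Ty.zero]

theorem Ty.zero_scale (p : ℚ≥0) (τ : Ty) : (τ.scale p).zero = τ.zero := by
  induction τ with
  | list τ q ih => simp [Ty.zero, Ty.scale, ih]
  | _ => simp [Ty.zero, Ty.scale]

theorem Share.zero_eq {τ τ₁ τ₂ : Ty} (h : Share τ τ₁ τ₂) :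
    τ.zero = τ₁.zero ∧ τ.zero = τ₂.zero := by
  induction h with
  | list hq hτ ih => simp [Ty.zero, ← ih.1, ← ih.2]
  | _ => simp [Ty.zero]

theorem SubTy.refl (τ : Ty) : SubTy τ τ := by
  induction τ with
  | unit => exact .unit
  | list τ q ih => exact .list ih le_rfl
  | arr τ q σ r ih₁ ih₂ => exact .arr ih₁ le_rfl ih₂ le_rfl
  | prob => exact .prob le_rfl le_rfl

theorem SubTy.trans {τ₁ τ₂ τ₃ : Ty} (h : SubTy τ₁ τ₂) (h' : SubTy τ₂ τ₃) : SubTy τ₁ τ₃ := by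
  induction τ₂ generalizing τ₁ τ₃ with
  | unit => cases h; cases h'; exact .unit
  | list τ q ih =>
    cases h with | list h hq => cases h' with | list h' hq' => exact .list (ih h h') (hq'.trans hq)
  | arr τ q σ r ih₁ ih₂ =>
    cases h with
    | arr hτ hq hσ hr =>
      cases h' with
      | arr hτ' hq' hσ' hr' =>
        exact .arr (ih₁ hτ' hτ) (hq.trans hq') (ih₂ hσ hσ') (hr'.trans hr)
  | prob =>
    cases h with
    | prob hH hT => cases h' with | prob hH' hT' => exact .prob (hH'.trans hH) (hT'.trans hT)

/-! ### Costs on a grid -/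

/-- The `k`-th point `k / N` of the grid of costs with denominator `N`. -/
def gridPoint (N k : ℕ) : Cost := ((k / N : ℚ≥0) : Cost)

/-- All `tick` constants of the expression are multiples of `1 / N`. -/
def Expr.OnGrid (N : ℕ) : Expr → Prop
  | .tick q => ∃ k : ℕ, q = k / N
  | .matL _ e₀ _ _ e₁ => e₀.OnGrid N ∧ e₁.OnGrid N
  | .fn _ _ e => e.OnGrid N
  | .letE e₁ _ e₂ => e₁.OnGrid N ∧ e₂.OnGrid N
  | .share _ _ _ e => e.OnGrid N
  | .flip _ e₁ e₂ => e₁.OnGrid N ∧ e₂.OnGrid N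
  | .flipS _ e₁ e₂ => e₁.OnGrid N ∧ e₂.OnGrid N
  | _ => True

theorem Expr.OnGrid.of_dvd {N M : ℕ} (hM : 0 < M) (hNM : N ∣ M) {e : Expr} (h : e.OnGrid N) :
    e.OnGrid M := by
  induction e with
  | tick q =>
    obtain ⟨k, rfl⟩ := h
    obtain ⟨d, rfl⟩ := hNM
    have hN : (N : ℚ≥0) ≠ 0 := by
      rintro h0
      simp [Nat.cast_eq_zero.1 h0] at hM
    have hd : (d : ℚ≥0) ≠ 0 := by
      rintro h0
      simp [Nat.cast_eq_zero.1 h0] at hM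
    refine ⟨k * d, ?_⟩
    push_cast
    field_simp
  | matL _ _ _ _ _ ih₀ ih₁ => exact ⟨ih₀ h.1, ih₁ h.2⟩
  | fn _ _ _ ih => exact ih h
  | letE _ _ _ ih₁ ih₂ => exact ⟨ih₁ h.1, ih₂ h.2⟩
  | share _ _ _ _ ih => exact ih h
  | flip _ _ _ ih₁ ih₂ => exact ⟨ih₁ h.1, ih₂ h.2⟩
  | flipS _ _ _ ih₁ ih₂ => exact ⟨ih₁ h.1, ih₂ h.2⟩
  | _ => trivial

theorem Expr.exists_onGrid (e : Expr) : ∃ N, 0 < N ∧ e.OnGrid N := by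
  have pair : ∀ e₁ e₂ : Expr, (∃ N, 0 < N ∧ e₁.OnGrid N) → (∃ N, 0 < N ∧ e₂.OnGrid N) →
      ∃ N, 0 < N ∧ e₁.OnGrid N ∧ e₂.OnGrid N := by
    rintro e₁ e₂ ⟨N₁, h₁, g₁⟩ ⟨N₂, h₂, g₂⟩
    have h := Nat.mul_pos h₁ h₂
    exact ⟨N₁ * N₂, h, g₁.of_dvd h (dvd_mul_right _ _), g₂.of_dvd h (dvd_mul_left _ _)⟩
  induction e with
  | tick q => exact ⟨q.den, q.den_pos, q.num, (NNRat.num_div_den q).symm⟩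
  | matL _ _ _ _ _ ih₀ ih₁ => exact pair _ _ ih₀ ih₁
  | fn _ _ _ ih => exact ih
  | letE _ _ _ ih₁ ih₂ => exact pair _ _ ih₁ ih₂
  | share _ _ _ _ ih => exact ih
  | flip _ _ _ ih₁ ih₂ => exact pair _ _ ih₁ ih₂
  | flipS _ _ _ ih₁ ih₂ => exact pair _ _ ih₁ ih₂
  | _ => exact ⟨1, one_pos, trivial⟩

/-- Value typing as the soundness proof needs it. It differs from `HasType` in the rule for
closures: the type of a closure may be any supertype of the arrow type at which its body is typed,
since `HasType` is not closed under subtyping (the body may use the recursive function at the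
smaller type), and the `tick` constants in the bodies are multiples of `1 / N`. -/
inductive GridTyped (N : ℕ) : Val → Ty → Prop
  | triv : GridTyped N .triv .unit
  | prob {p : Prob} {qH qT : ℚ≥0} : GridTyped N (.prob p) (.prob qH qT)
  | nil {τ : Ty} {q : ℚ≥0} : GridTyped N .nil (.list τ q)
  | cons {v₁ v₂ : Val} {τ : Ty} {q : ℚ≥0} (h₁ : GridTyped N v₁ τ)
      (h₂ : GridTyped N v₂ (.list τ q)) : GridTyped N (.cons v₁ v₂) (.list τ q)
  | clo {V : Env} {Γ : Ctx} {f x : Var} {τ σ : Ty} {q : ℚ≥0} {e : Expr} {B : PTy}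
      (hV : ∀ y σ, Γ y = some σ → GridTyped N (V y) σ) (he : e.OnGrid N)
      (h : Typing ((Γ.zero.ext f (.arr τ q B.ty B.pot)).ext x τ) q e B)
      (hσ : SubTy (.arr τ q B.ty B.pot) σ) : GridTyped N (.clo V f x e) σ

theorem GridTyped.fits {N : ℕ} {v : Val} {τ : Ty} (h : GridTyped N v τ) : v.Fits τ := by
  induction h with
  | cons _ _ ih₁ ih₂ => exact ⟨ih₁, ih₂⟩
  | clo _ _ _ hσ => cases hσ; trivial
  | _ => trivial

theorem GridTyped.of_subTy {N : ℕ} {v : Val} {τ τ' : Ty} (h : GridTyped N v τ)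
    (hτ : SubTy τ τ') : GridTyped N v τ' := by
  induction h generalizing τ' with
  | cons _ _ ih₁ ih₂ =>
    cases hτ with
    | list hτ hq => exact .cons (ih₁ hτ) (ih₂ (.list hτ hq))
  | clo hV he h hσ _ => exact .clo hV he h (hσ.trans hτ)
  | triv => cases hτ; exact .triv
  | prob => cases hτ; exact .prob
  | nil => cases hτ; exact .nil

/-- Value typing does not depend on the annotations outside of arrow types. -/
theorem GridTyped.of_zero_eq {N : ℕ} {v : Val} {τ τ' : Ty} (h : GridTyped N v τ)
    (hτ : τ.zero = τ'.zero) : GridTyped N v τ' := by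
  induction h generalizing τ' with
  | triv => cases τ' <;> simp [Ty.zero] at hτ; exact .triv
  | prob => cases τ' <;> simp [Ty.zero] at hτ; exact .prob
  | nil => cases τ' <;> simp [Ty.zero] at hτ; exact .nil
  | cons _ _ ih₁ ih₂ =>
    cases τ' with
    | list σ r => exact .cons (ih₁ (by simpa [Ty.zero] using hτ)) (ih₂ hτ)
    | _ => simp [Ty.zero] at hτ
  | @clo _ _ _ _ _ σ _ _ _ hV he h hσ _ =>
    have : σ = τ' := by cases hσ; cases τ' <;> simp_all [Ty.zero]
    exact this ▸ .clo hV he h hσ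

/-- `V : Γ` for the value typing `GridTyped`. -/
def Env.GridCtx (N : ℕ) (V : Env) (Γ : Ctx) : Prop := ∀ x τ, Γ x = some τ → GridTyped N (V x) τ

theorem GridTyped.of_dvd {N M : ℕ} (hM : 0 < M) (hNM : N ∣ M) {v : Val} {τ : Ty}
    (h : GridTyped N v τ) : GridTyped M v τ := by
  induction h with
  | triv => exact .triv
  | prob => exact .prob
  | nil => exact .nil
  | cons _ _ ih₁ ih₂ => exact .cons ih₁ ih₂
  | clo _ he h hσ ih => exact .clo ih (he.of_dvd hM hNM) h hσ

theorem Env.exists_gridCtx {V : Env} {Γ : Ctx} (hΓ : {x | Γ x ≠ none}.Finite)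
    (h : ∀ x τ, Γ x = some τ → ∃ N, 0 < N ∧ GridTyped N (V x) τ) :
    ∃ N, 0 < N ∧ V.GridCtx N Γ := by
  have h' : ∀ x, ∃ N, 0 < N ∧ ∀ τ, Γ x = some τ → GridTyped N (V x) τ := by
    intro x
    cases hx : Γ x with
    | none => exact ⟨1, one_pos, by simp⟩
    | some τ =>
      obtain ⟨N, hN, ht⟩ := h x τ hx
      exact ⟨N, hN, by simpa using ht⟩
  choose N hN ht using h'
  have hpos : 0 < ∏ x ∈ hΓ.toFinset, N x := Finset.prod_pos fun x _ => hN x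
  refine ⟨_, hpos, fun x τ hx => (ht x τ hx).of_dvd hpos (Finset.dvd_prod_of_mem N ?_)⟩
  simp [hx]

/-- A well-typed value is well-typed for some grid: its closures have finitely many relevant
variables, so only finitely many `tick` constants matter. -/
theorem HasType.exists_gridTyped {v : Val} {τ : Ty} (h : HasType v τ) :
    ∃ N, 0 < N ∧ GridTyped N v τ := by
  induction h with
  | triv => exact ⟨1, one_pos, .triv⟩
  | prob => exact ⟨1, one_pos, .prob⟩
  | nil => exact ⟨1, one_pos, .nil⟩
  | cons _ _ ih₁ ih₂ =>
    obtain ⟨N₁, h₁, g₁⟩ := ih₁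
    obtain ⟨N₂, h₂, g₂⟩ := ih₂
    have h := Nat.mul_pos h₁ h₂
    exact ⟨N₁ * N₂, h, .cons (g₁.of_dvd h (dvd_mul_right _ _)) (g₂.of_dvd h (dvd_mul_left _ _))⟩
  | @clo V Γ f x τ q e B hV h ih =>
    have hΓ : {y | Γ y ≠ none}.Finite := by
      refine h.finite_dom.subset fun y hy => ?_
      simp only [mem_ofPred_eq, Ctx.ext, update_apply, Ctx.zero]
      split_ifs <;> simp_all
    obtain ⟨N₁, h₁, g₁⟩ := Env.exists_gridCtx hΓ ih
    obtain ⟨N₂, h₂, g₂⟩ := e.exists_onGrid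
    have hN := Nat.mul_pos h₁ h₂
    exact ⟨N₁ * N₂, hN, .clo (fun y σ hy => (g₁ y σ hy).of_dvd hN (dvd_mul_right _ _))
      (g₂.of_dvd hN (dvd_mul_left _ _)) h (SubTy.refl _)⟩

namespace Env.GridCtx

variable {N : ℕ} {V : Env} {Γ Γ₁ Γ₂ : Ctx}

theorem of_dvd {M : ℕ} (hM : 0 < M) (hNM : N ∣ M) (h : V.GridCtx N Γ) : V.GridCtx M Γ :=
  fun x τ hx => (h x τ hx).of_dvd hM hNM

theorem update_ext (h : V.GridCtx N Γ) (x : Var) {v : Val} {τ : Ty} (hv : GridTyped N v τ) :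
    Env.GridCtx N (update V x v) (Γ.ext x τ) := by
  intro y σ hy
  by_cases hyx : y = x
  · subst hyx
    rw [Γ.ext_self] at hy
    obtain rfl := Option.some.inj hy
    rwa [update_self]
  · rw [Γ.ext_of_ne _ hyx] at hy
    rw [update_of_ne hyx]
    exact h y σ hy

theorem of_ext {x : Var} {τ : Ty} (h : V.GridCtx N (Γ.ext x τ)) (hx : Γ x = none) :
    V.GridCtx N Γ := by
  intro y σ hy
  refine h y σ ?_
  rw [Γ.ext_of_ne _ (by rintro rfl; simp [hx] at hy), hy]

theorem typed_self {x : Var} {τ : Ty} (h : V.GridCtx N (Γ.ext x τ)) : GridTyped N (V x) τ :=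
  h x τ (Γ.ext_self x τ)

theorem zero (h : V.GridCtx N Γ) : V.GridCtx N Γ.zero := by
  intro x τ hx
  obtain ⟨σ, hσ, rfl⟩ := Option.map_eq_some_iff.1 hx
  exact (h x σ hσ).of_zero_eq σ.zero_zero.symm

theorem of_join (h : V.GridCtx N (Γ₁.join Γ₂)) (hd : Γ₁.Disj Γ₂) :
    V.GridCtx N Γ₁ ∧ V.GridCtx N Γ₂ := by
  refine ⟨fun x τ hx => h x τ (by simp [Ctx.join, hx]), fun x τ hx => h x τ ?_⟩
  rcases hd x with h' | h'
  · simp [Ctx.join, hx, h']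
  · simp [h'] at hx

theorem of_share_scale {p₁ p₂ : ℚ≥0} (h : V.GridCtx N Γ)
    (hs : Γ.Share (Γ₁.scale p₁) (Γ₂.scale p₂)) : V.GridCtx N Γ₁ ∧ V.GridCtx N Γ₂ := by
  constructor
  all_goals
    intro x τ hx
    rcases hs x with ⟨-, h1, h2⟩ | ⟨σ, σ₁, σ₂, h0, h1, h2, hσ⟩
    · simp [Ctx.scale, hx] at h1 h2
    · simp only [Ctx.scale, hx, Option.map_some, Option.some.injEq] at h1 h2
      first | subst h1 | subst h2
      refine (h x σ h0).of_zero_eq ?_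
      rw [← Ty.zero_scale _ τ]
      first | exact hσ.zero_eq.1 | exact hσ.zero_eq.2

theorem of_ext_subTy {x : Var} {τ τ' : Ty} (h : V.GridCtx N (Γ.ext x τ')) (hτ : SubTy τ' τ) :
    V.GridCtx N (Γ.ext x τ) := by
  intro y σ hy
  by_cases hyx : y = x
  · subst hyx
    rw [Γ.ext_self] at hy
    obtain rfl := Option.some.inj hy
    exact h.typed_self.of_subTy hτ
  · refine h y σ ?_
    rwa [Γ.ext_of_ne _ hyx] at hy ⊢

end Env.GridCtx

/-! ### Soundness at every evaluation depth -/

/-- The amount that an outcome of an expression of type `A` is charged: the cost, and the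
potential of the result if there is one. -/
noncomputable def charge (A : PTy) : Outcome → ℝ≥0∞
  | (none, c) => c.toENNReal
  | (some v, c) => ratToENNReal (v.ppotential A) + c.toENNReal

theorem charge_eq (τ : Ty) (q : ℚ≥0) (v : Val) (c : Cost) :
    charge ⟨τ, q⟩ (some v, c) =
      ratToENNReal (v.potential τ) + ratToENNReal q + c.toENNReal := by
  simp [charge, Val.ppotential, ratToENNReal_add]

/-- The part of the soundness statement that concerns a single distribution: the values are
well-typed, the costs lie on the grid, and the expected charge is at most `b`. -/
structure Bounded (N : ℕ) (A : PTy) (b : ℝ≥0∞) (μ : PMF Outcome) : Prop where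
  typed : ∀ v c, μ (some v, c) ≠ 0 → GridTyped N v A.ty
  grid : ∀ o, μ o ≠ 0 → o.2 ∈ range (gridPoint N)
  charge_le : expect μ (charge A) ≤ b

theorem gridPoint_zero (N : ℕ) : gridPoint N 0 = 0 := by simp [gridPoint]

theorem gridPoint_add (N j k : ℕ) : gridPoint N (j + k) = gridPoint N j + gridPoint N k := by
  simp [gridPoint, add_div]

namespace Bounded

variable {N : ℕ} {A : PTy} {b b' : ℝ≥0∞} {μ : PMF Outcome}

theorem mono (h : Bounded N A b μ) (hb : b ≤ b') : Bounded N A b' μ :=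
  ⟨h.typed, h.grid, h.charge_le.trans hb⟩

theorem pure_none : Bounded N A b (PMF.pure (none, 0)) where
  typed v c hv := by classical simp [PMF.pure_apply] at hv
  grid o ho := by
    rw [← PMF.mem_support_iff, PMF.mem_support_pure_iff] at ho
    exact ⟨0, by rw [ho, gridPoint_zero]⟩
  charge_le := by simp [expect_pure, charge]

theorem pure_some {v : Val} {c : Cost} (hv : GridTyped N v A.ty)
    (hc : c ∈ range (gridPoint N)) (hb : charge A (some v, c) ≤ b) :
    Bounded N A b (PMF.pure (some v, c)) where
  typed w d hw := by
    rw [← PMF.mem_support_iff, PMF.mem_support_pure_iff, Prod.mk.injEq, Option.some.injEq] at hw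
    exact hw.1 ▸ hv
  grid o ho := by
    rw [← PMF.mem_support_iff, PMF.mem_support_pure_iff] at ho
    exact ho ▸ hc
  charge_le := by rwa [expect_pure]

/-- The point distributions of values that cost nothing and whose potential is at most `b`. -/
theorem pure_value {v : Val} (hv : GridTyped N v A.ty) (hb : ratToENNReal (v.ppotential A) ≤ b) :
    Bounded N A b (PMF.pure (some v, 0)) :=
  pure_some hv ⟨0, gridPoint_zero N⟩ (by simpa [charge] using hb)

theorem mix {p : Prob} {μ₁ μ₂ : PMF Outcome} {b₁ b₂ : ℝ≥0∞} (h₁ : Bounded N A b₁ μ₁)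
    (h₂ : Bounded N A b₂ μ₂) :
    Bounded N A (ratToENNReal p.1 * b₁ + ratToENNReal p.compl.1 * b₂) (mix p μ₁ μ₂) := by
  have hor : ∀ o, AARA.mix p μ₁ μ₂ o ≠ 0 → μ₁ o ≠ 0 ∨ μ₂ o ≠ 0 := by
    intro o ho
    by_contra! h
    simp [mix_apply, h] at ho
  refine ⟨fun v c h => ?_, fun o h => ?_, ?_⟩
  · rcases hor _ h with h | h
    exacts [h₁.typed v c h, h₂.typed v c h]
  · rcases hor _ h with h | h
    exacts [h₁.grid o h, h₂.grid o h]
  · rw [expect_mix]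
    gcongr
    exacts [h₁.charge_le, h₂.charge_le]

/-- The charge `p` for the result of the first expression pays for the second one, whose other
resources `b'` are the same for all results of the first. -/
theorem seqDist {τ : Ty} {p : ℚ≥0} {κ : Val → Cost → PMF Outcome}
    (h : Bounded N ⟨τ, p⟩ b μ)
    (hκ : ∀ v c, μ (some v, c) ≠ 0 →
      Bounded N A (b' + ratToENNReal (v.potential τ) + ratToENNReal p) (κ v c)) :
    Bounded N A (b + b') (seqDist μ κ) := by
  refine ⟨fun v c hv => ?_, fun o ho => ?_, ?_⟩
  · rcases seqDist_ne_zero hv with ⟨h0, -⟩ | ⟨v₁, q₁, ⟨o, q₂⟩, h₁, h₂, ho⟩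
    · simp at h0
    · obtain ⟨rfl, -⟩ := Prod.mk.inj ho
      exact (hκ v₁ q₁ h₁).typed v q₂ h₂
  · rcases seqDist_ne_zero ho with ⟨-, h0⟩ | ⟨v₁, q₁, o₂, h₁, h₂, rfl⟩
    · exact h.grid o h0
    · obtain ⟨j, hj⟩ := h.grid _ h₁
      obtain ⟨k, hk⟩ := (hκ v₁ q₁ h₁).grid _ h₂
      exact ⟨j + k, by rw [gridPoint_add, hj, hk]⟩
  · rw [expect_seqDist]
    calc expect μ (seqWeight κ (charge A))
        ≤ expect μ fun o => charge ⟨τ, p⟩ o + b' := expect_mono fun o ho => ?_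
      _ = expect μ (charge ⟨τ, p⟩) + b' := by rw [expect_add, expect_const]
      _ ≤ b + b' := by gcongr; exact h.charge_le
    rcases o with ⟨_ | v, q₁⟩
    · exact le_self_add
    · have hsplit : ∀ o : Outcome, charge A (o.1, q₁ + o.2) = charge A o + q₁.toENNReal := by
        rintro ⟨_ | w, q₂⟩ <;> simp only [charge, Cost.toENNReal_add] <;> ring
      simp only [seqWeight, hsplit, expect_add, expect_const, charge_eq]
      calc expect (κ v q₁) (charge A) + q₁.toENNReal
          ≤ b' + ratToENNReal (v.potential τ) + ratToENNReal p + q₁.toENNReal := by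
            gcongr
            exact (hκ v q₁ ho).charge_le
        _ = ratToENNReal (v.potential τ) + ratToENNReal p + q₁.toENNReal + b' := by ring

theorem of_subTy {τ τ' : Ty} {q : ℚ≥0} (h : Bounded N ⟨τ', q⟩ b μ) (hτ : SubTy τ' τ) :
    Bounded N ⟨τ, q⟩ b μ := by
  refine ⟨fun v c hv => (h.typed v c hv).of_subTy hτ, h.grid, le_trans ?_ h.charge_le⟩
  refine expect_mono fun o _ => ?_
  rcases o with ⟨_ | v, c⟩
  · exact le_rfl
  · rw [charge_eq, charge_eq]
    gcongr
    exact ratToENNReal_mono (hτ.potential_le v)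

/-- If the result type gains potential, the gain is paid by the surplus, because the total
probability of the terminating outcomes is at most `1`. -/
theorem relax {τ : Ty} {p p' q q' : ℚ≥0} (h : Bounded N ⟨τ, p'⟩ (b + ratToENNReal p) μ)
    (hq : p ≤ q) (hq' : p + q' ≤ q + p') : Bounded N ⟨τ, q'⟩ (b + ratToENNReal q) μ := by
  -- `d` is the truncated difference `q' - p'`, the gain of the result.
  obtain ⟨d, hd, hpd⟩ : ∃ d, q' ≤ p' + d ∧ p + d ≤ q := by
    rcases le_total q' p' with h' | h'
    · exact ⟨0, by simpa using h', by simpa using hq⟩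
    · obtain ⟨d, rfl⟩ := exists_add_of_le h'
      refine ⟨d, le_rfl, ?_⟩
      rw [← add_assoc, add_right_comm] at hq'
      exact le_of_add_le_add_right hq'
  refine ⟨h.typed, h.grid, ?_⟩
  calc expect μ (charge ⟨τ, q'⟩)
      ≤ expect μ fun o => charge ⟨τ, p'⟩ o + ratToENNReal d := expect_mono fun o _ => ?_
    _ = expect μ (charge ⟨τ, p'⟩) + ratToENNReal d := by rw [expect_add, expect_const]
    _ ≤ b + ratToENNReal p + ratToENNReal d := by gcongr; exact h.charge_le
    _ = b + ratToENNReal (p + d) := by rw [ratToENNReal_add, add_assoc]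
    _ ≤ b + ratToENNReal q := by gcongr; exact ratToENNReal_mono hpd
  rcases o with ⟨_ | v, c⟩
  · exact le_self_add
  · rw [charge_eq, charge_eq]
    calc _ ≤ ratToENNReal (v.potential τ) + ratToENNReal (p' + d) + c.toENNReal := by
          gcongr
          exact ratToENNReal_mono hd
      _ = _ := by rw [ratToENNReal_add]; ring

end Bounded

/-- Soundness at depth `n`. The structural typing rules keep the expression and hence the depth, so
the induction is on the depth and, for a fixed depth, on the typing derivation. -/
theorem Typing.exists_step {N : ℕ} (n : ℕ) {Γ : Ctx} {q : ℚ≥0} {e : Expr} {A : PTy}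
    (h : Typing Γ q e A) (he : e.OnGrid N) {V : Env} (hV : V.GridCtx N Γ) :
    ∃ μ, Step V e n μ ∧ Bounded N A (V.potential Γ + ratToENNReal q) μ := by
  induction n generalizing Γ q e A V with
  | zero => exact ⟨_, .base, .pure_none⟩
  | succ n ih =>
    induction h generalizing V with
    | @var x τ =>
      refine ⟨_, .var, .pure_value hV.typed_self ?_⟩
      rw [V.potential_ext τ rfl]
      simp only [Val.ppotential, add_zero]
      exact le_add_right le_add_self
    | triv => exact ⟨_, .triv, .pure_value .triv (by simp [Val.ppotential, Val.potential])⟩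
    | nil => exact ⟨_, .nil, .pure_value .nil (by simp [Val.ppotential, Val.potential])⟩
    | @cons x₁ x₂ τ p hx =>
      have h0 : Ctx.empty.ext x₁ τ x₂ = none := by rw [Ctx.ext_of_ne _ _ hx.symm]; rfl
      refine ⟨_, .cons, .pure_value (.cons (hV.of_ext h0).typed_self hV.typed_self) ?_⟩
      rw [V.potential_ext _ h0, V.potential_ext _ rfl]
      simp only [Val.ppotential, Val.potential, add_zero, ratToENNReal_add]
      calc _ = ratToENNReal ((V x₁).potential τ) + ratToENNReal ((V x₂).potential (.list τ p)) +
            ratToENNReal p := by ring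
        _ ≤ _ := by gcongr; exact le_add_self
    | @matL Γ x x₁ x₂ τ p q e₀ e₁ B hx h₀ h₁ =>
      have hx' := hV.typed_self
      have hΓ := hV.of_ext hx
      rw [V.potential_ext _ hx]
      generalize hv : V x = v at hx'
      cases hx' with
      | clo _ _ _ hσ => cases hσ
      | nil =>
        obtain ⟨μ, hμ, hb⟩ := ih h₀ he.1 hΓ
        refine ⟨μ, .matL_nil hv hμ, hb.mono ?_⟩
        gcongr
        exact le_self_add
      | @cons v₁ v₂ _ _ t₁ t₂ =>
        obtain ⟨μ, hμ, hb⟩ := ih h₁ he.2 ((hΓ.update_ext x₁ t₁).update_ext x₂ t₂)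
        refine ⟨μ, .matL_cons hv hμ, hb.mono ?_⟩
        have hp := Env.potential_update_ext_le V Γ x₁ v₁ τ
        have hp' := Env.potential_update_ext_le (update V x₁ v₁) (Γ.ext x₁ τ) x₂ v₂ (.list τ p)
        simp only [Val.potential, ratToENNReal_add]
        calc _ ≤ V.potential Γ + ratToENNReal (v₁.potential τ) +
              ratToENNReal (v₂.potential (.list τ p)) + (ratToENNReal q + ratToENNReal p) := by
              gcongr
              exact hp'.trans (by gcongr)
          _ = _ := by ring
    | @tick q =>
      obtain ⟨k, hk⟩ := he
      refine ⟨_, .tick, .pure_some .triv ⟨k, by rw [hk]; rfl⟩ ?_⟩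
      simp [charge, Val.ppotential, Val.potential]
    | @letE Γ₁ Γ₂ x τ p q e₁ e₂ B hd h₁ h₂ =>
      obtain ⟨hV₁, hV₂⟩ := hV.of_join hd
      obtain ⟨μ, hμ, hb⟩ := ih h₁ he.1 hV₁
      have hκ : ∀ v₁ (q₁ : Cost), ∃ ν, μ (some v₁, q₁) ≠ 0 → Step (update V x v₁) e₂ n ν ∧
          Bounded N B (V.potential Γ₂ + ratToENNReal (v₁.potential τ) + ratToENNReal p) ν := by
        intro v₁ q₁
        by_cases h0 : μ (some v₁, q₁) = 0
        · exact ⟨μ, fun h => absurd h0 h⟩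
        · obtain ⟨ν, hν, hb'⟩ := ih h₂ he.2 (hV₂.update_ext x (hb.typed v₁ q₁ h0))
          exact ⟨ν, fun _ => ⟨hν, hb'.mono (by
            gcongr
            exact Env.potential_update_ext_le V Γ₂ x v₁ τ)⟩⟩
      choose κ hκ using hκ
      refine ⟨_, .letE hμ fun v₁ q₁ h0 => (hκ v₁ q₁ h0).1, ?_⟩
      rw [V.potential_join hd, add_right_comm]
      exact hb.seqDist fun v₁ q₁ h0 => (hκ v₁ q₁ h0).2
    | @app x₁ x₂ τ q B hx =>
      have h0 : Ctx.empty.ext x₁ (.arr τ q B.ty B.pot) x₂ = none := by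
        rw [Ctx.ext_of_ne _ _ hx.symm]; rfl
      have t₁ := (hV.of_ext h0).typed_self
      have t₂ := hV.typed_self
      generalize hv : V x₁ = v at t₁
      cases t₁ with
      | @clo V' Γ' f x τ' σ' q' e' B' hV' he' hbody hσ =>
        have ⟨hτ, hq, hB, hr⟩ : SubTy τ τ' ∧ q' ≤ q ∧ SubTy B'.ty B.ty ∧ B.pot ≤ B'.pot := by
          cases hσ with | arr hτ hq hσ hr => exact ⟨hτ, hq, hσ, hr⟩
        have hctx := ((Env.GridCtx.zero hV').update_ext f
          (.clo hV' he' hbody (SubTy.refl _))).update_ext x (t₂.of_subTy hτ)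
        obtain ⟨μ, hμ, hb⟩ := ih hbody he' hctx
        refine ⟨μ, .app hv hμ, ?_⟩
        -- The environment of a closure has no potential, since its context is `|Γ'|`.
        have hpot : Env.potential (update (update V' f (.clo V' f x e')) x (V x₂))
            ((Γ'.zero.ext f (.arr τ' q' B'.ty B'.pot)).ext x τ') ≤
              ratToENNReal ((V x₂).potential τ') := by
          refine (Env.potential_update_ext_le _ _ _ _ _).trans ?_
          refine (add_le_add_left (Env.potential_update_ext_le _ _ _ _ _) _).trans ?_
          simp [Env.potential_zero, Val.potential]
        have hle : Env.potential (update (update V' f (.clo V' f x e')) x (V x₂))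
            ((Γ'.zero.ext f (.arr τ' q' B'.ty B'.pot)).ext x τ') + ratToENNReal q' ≤
            V.potential ((Ctx.empty.ext x₁ (.arr τ q B.ty B.pot)).ext x₂ τ) +
              ratToENNReal q := by
          rw [V.potential_ext _ h0]
          gcongr
          · exact (hpot.trans (ratToENNReal_mono (hτ.potential_le _))).trans le_add_self
          · exact ratToENNReal_mono hq
        have hb' := (hb.mono hle).of_subTy (τ := B.ty) (τ' := B'.ty) (q := B'.pot) hB
        exact hb'.relax le_rfl (add_le_add_right hr q)
    | @fn Γ f x τ q e B hΓ h =>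
      refine ⟨_, .fn, .pure_value (.clo hV he ?_ (SubTy.refl _)) ?_⟩
      · rw [← hΓ]; exact h
      · simp [Val.ppotential, Val.potential]
    | @share Γ x x₁ x₂ τ τ₁ τ₂ q e B hx hτ h =>
      have t := hV.typed_self
      obtain ⟨μ, hμ, hb⟩ := ih h he
        (((hV.of_ext hx).update_ext x₁ (t.of_zero_eq hτ.zero_eq.1)).update_ext x₂
          (t.of_zero_eq hτ.zero_eq.2))
      refine ⟨μ, .share hμ, hb.mono ?_⟩
      rw [V.potential_ext _ hx, hτ.potential, ratToENNReal_add, ← add_assoc]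
      gcongr
      refine (Env.potential_update_ext_le _ _ _ _ _).trans ?_
      gcongr
      exact Env.potential_update_ext_le _ _ _ _ _
    | @flip Γ Γ₁ Γ₂ p q q₁ q₂ e₁ e₂ A hΓ hq h₁ h₂ =>
      obtain ⟨hV₁, hV₂⟩ := hV.of_share_scale hΓ
      obtain ⟨μ₁, hμ₁, hb₁⟩ := ih h₁ he.1 hV₁
      obtain ⟨μ₂, hμ₂, hb₂⟩ := ih h₂ he.2 hV₂
      refine ⟨_, .flip hμ₁ hμ₂, (hb₁.mix hb₂).mono (le_of_eq ?_)⟩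
      rw [V.potential_share_scale hΓ, hq, ratToENNReal_add, ratToENNReal_mul, ratToENNReal_mul]
      ring
    | @prob p q qH qT hq =>
      refine ⟨_, .prob, .pure_value .prob ?_⟩
      refine (ratToENNReal_mono (le_of_eq ?_)).trans le_add_self
      rw [hq, Val.ppotential, Val.potential]
      ring
    | @flipS Γ x q qH qT e₁ e₂ A hx h₁ h₂ =>
      have hx' := hV.typed_self
      have hΓ := hV.of_ext hx
      rw [V.potential_ext _ hx]
      generalize hv : V x = v at hx'
      cases hx' with
      | clo _ _ _ hσ => cases hσ
      | @prob p =>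
        obtain ⟨μ₁, hμ₁, hb₁⟩ := ih h₁ he.1 hΓ
        obtain ⟨μ₂, hμ₂, hb₂⟩ := ih h₂ he.2 hΓ
        refine ⟨_, .flipS hv hμ₁ hμ₂, (hb₁.mix hb₂).mono (le_of_eq ?_)⟩
        simp only [Val.potential, ratToENNReal_add, ratToENNReal_mul]
        have hsum := ratToENNReal_prob_add_compl p
        set a := ratToENNReal p.1
        set b := ratToENNReal p.compl.1
        calc _ = (a + b) * (V.potential Γ + ratToENNReal q) +
              (ratToENNReal qH * a + ratToENNReal qT * b) := by ring
          _ = _ := by rw [hsum]; ring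
    | sub h hτ ih' =>
      obtain ⟨μ, hμ, hb⟩ := ih' he hV
      exact ⟨μ, hμ, hb.of_subTy hτ⟩
    | sup h hτ ih' =>
      obtain ⟨μ, hμ, hb⟩ := ih' he (hV.of_ext_subTy hτ)
      refine ⟨μ, hμ, hb.mono ?_⟩
      gcongr
      exact V.potential_ext_le_of_subTy _ _ hτ
    | weak hx h ih' =>
      obtain ⟨μ, hμ, hb⟩ := ih' he (hV.of_ext hx)
      refine ⟨μ, hμ, hb.mono ?_⟩
      rw [V.potential_ext _ hx]
      gcongr
      exact le_self_add
    | relax h hq hq' ih' =>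
      obtain ⟨μ, hμ, hb⟩ := ih' he hV
      exact ⟨μ, hμ, hb.relax hq hq'⟩

/-! ### The least upper bound of a chain with costs on a grid -/

theorem tsum_option_eq_add {α : Type} (f : Option α → ℝ≥0∞) :
    ∑' o, f o = f none + ∑' a, f (some a) := by
  rw [ENNReal.tsum_eq_add_tsum_ite none, ← (Option.some_injective α).tsum_eq]
  · simp
  · rintro (_ | a) h
    · simp at h
    · exact mem_range_self a

theorem tsum_iSup_of_monotone {α : Type} {f : ℕ → α → ℝ≥0∞} (hf : ∀ a, Monotone fun n => f n a) :
    ∑' a, ⨆ n, f n a = ⨆ n, ∑' a, f n a := by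
  simp only [ENNReal.tsum_eq_iSup_sum]
  rw [iSup_comm]
  exact iSup_congr fun s => ENNReal.finsetSum_iSup_of_monotone hf

open Filter Topology in
theorem iInf_add_tsum_of_telescoping {r s : ℕ → ℝ≥0∞} (h : ∀ k, r k + s (k + 1) = s k) (k : ℕ) :
    (⨅ j, s j) + ∑' j, r (k + j) = s k := by
  have hs : Antitone s := antitone_nat_of_succ_le fun j => h j ▸ le_add_self
  have hpart : ∀ J, s (k + J) + ∑ j ∈ Finset.range J, r (k + j) = s k := by
    intro J
    induction J with
    | zero => simp
    | succ J ih =>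
      rw [Finset.sum_range_succ, ← ih, ← h (k + J)]
      ring_nf
  have ht : Tendsto (fun J => s (k + J) + ∑ j ∈ Finset.range J, r (k + j)) atTop
      (𝓝 ((⨅ j, s j) + ∑' j, r (k + j))) := by
    refine Tendsto.add ?_ (ENNReal.tendsto_nat_tsum _)
    exact (tendsto_atTop_iInf hs).comp (tendsto_add_atTop_nat k |>.congr fun J => add_comm J k)
  exact tendsto_nhds_unique (ht.congr hpart) tendsto_const_nhds

theorem exists_le_lt_succ {g : ℕ → Cost} (h0 : g 0 = 0) (hcof : ∀ q : ℚ≥0, ∃ k, (q : Cost) < g k)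
    {c : Cost} (hc : c ≠ ⊤) : ∃ k, g k ≤ c ∧ c < g (k + 1) := by
  classical
  lift c to ℚ≥0 using hc
  have h := Nat.find_spec (hcof c)
  have hmin := fun m => Nat.find_min (m := m) (hcof c)
  generalize Nat.find (hcof c) = j at h hmin
  cases j with
  | zero => simp [h0] at h
  | succ k => exact ⟨k, not_lt.1 (hmin k k.lt_succ_self), h⟩

theorem lt_iff_of_mem_grid {g : ℕ → Cost} (hg : StrictMono g) {k : ℕ} {c d : Cost}
    (hd : d = ⊤ ∨ d ∈ range g) (h₁ : g k ≤ c) (h₂ : c < g (k + 1)) : c < d ↔ g (k + 1) ≤ d := by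
  rcases hd with rfl | ⟨j, rfl⟩
  · simp [h₂.trans_le le_top]
  · refine ⟨fun h => ?_, h₂.trans_le⟩
    exact hg.monotone (Nat.succ_le_of_lt (hg.lt_iff_lt.1 (h₁.trans_lt h)))

/-- A chain of distributions with costs on a grid has a supremum: the probabilities of the
terminating outcomes are the suprema of those of the chain, and so are the tail probabilities. The
mass `s k` at or above the `k`-th grid point is prescribed by the tails, so the mass of the partial
evaluation at the `k`-th point has to be `s k - s (k + 1)` minus that of the terminating outcomes,
and what escapes along the grid, `⨅ k, s k`, sits at the cost `⊤`. -/
theorem exists_sup_of_chain {g : ℕ → Cost} (hg : StrictMono g) (h0 : g 0 = 0)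
    (hcof : ∀ q : ℚ≥0, ∃ k, (q : Cost) < g k) {μs : ℕ → PMF Outcome}
    (hchain : ∀ n, DistLE (μs n) (μs (n + 1))) (hsupp : ∀ n o, μs n o ≠ 0 → o.2 ∈ range g) :
    ∃ μ : PMF Outcome, (∀ v c, μ (some v, c) = ⨆ n, μs n (some v, c)) ∧
      (∀ c, tail μ c = ⨆ n, tail (μs n) c) ∧ ∀ o, μ o ≠ 0 → o.2 = ⊤ ∨ o.2 ∈ range g := by
  classical
  have hval : ∀ v c, Monotone fun n => μs n (some v, c) :=
    fun v c => monotone_nat_of_le_succ fun n => (hchain n).1 v c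
  have htail : ∀ c, Monotone fun n => tail (μs n) c :=
    fun c => monotone_nat_of_le_succ fun n => (hchain n).tail_le c
  have htop : ∀ k, g k ≠ ⊤ := fun k => ((hg k.lt_succ_self).trans_le le_top).ne
  let s : ℕ → ℝ≥0∞ := fun k => k.casesOn 1 fun j => ⨆ n, tail (μs n) (g j)
  let S : ℕ → ℝ≥0∞ := fun k => ∑' v, ⨆ n, μs n (some v, g k)
  have hpoint : ∀ n k, ∑' v, μs n (some v, g k) ≤
      expect (μs n) fun o => if o.2 = g k then 1 else 0 := by
    intro n k
    refine le_trans (le_of_eq ?_) (ENNReal.tsum_comp_le_tsum_of_injective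
      (f := fun v : Val => ((some v, g k) : Outcome)) (fun v w h => by simpa using h) _)
    simp
  -- The truncated subtraction in the mass of the partial evaluation below is exact.
  have hS : ∀ k, S k + s (k + 1) ≤ s k := by
    intro k
    have h1 : S k + s (k + 1) = ⨆ n, (∑' v, μs n (some v, g k) + tail (μs n) (g k)) := by
      rw [show S k = _ from tsum_iSup_of_monotone fun v => hval v (g k)]
      exact ENNReal.iSup_add_iSup_of_monotone
        (fun m n hmn => ENNReal.tsum_le_tsum fun v => hval v (g k) hmn) (htail (g k))
    rw [h1]
    refine iSup_le fun n => (add_le_add_left (hpoint n k) _).trans ?_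
    rw [tail, ← expect_add]
    cases k with
    | zero =>
      refine le_trans (expect_mono fun o _ => ?_) (expect_const (μs n) 1).le
      split_ifs with h1 h2 <;> simp_all
    | succ k =>
      refine le_trans (expect_mono fun o _ => ?_) (le_iSup (fun n => tail (μs n) (g k)) n)
      have hk : g k < g (k + 1) := hg k.lt_succ_self
      by_cases h1 : o.2 = g (k + 1)
      · simp [h1, hk]
      · by_cases h2 : g (k + 1) < o.2
        · simp [h1, h2, hk.trans h2]
        · simp [h1, h2]
  -- `m c` is the mass of the partial evaluation with cost `c`, and `R c` that of all outcomes.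
  let m : Cost → ℝ≥0∞ := extend g (fun k => s k - (S k + s (k + 1)))
    fun c => if c = ⊤ then ⨅ k, s k else 0
  let f : Outcome → ℝ≥0∞ := fun o => o.1.elim (m o.2) fun v => ⨆ n, μs n (some v, o.2)
  let R : Cost → ℝ≥0∞ := fun c => ∑' o, f (o, c)
  have hR : ∀ c, R c = m c + ∑' v, ⨆ n, μs n (some v, c) := fun c => tsum_option_eq_add _
  have hsome : ∀ c, c ∉ range g → ∀ v n, μs n (some v, c) = 0 := by
    intro c hc v n
    by_contra h
    exact hc (hsupp n _ h)
  have hRg : ∀ k, R (g k) + s (k + 1) = s k := by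
    intro k
    rw [hR, show m (g k) = _ from hg.injective.extend_apply _ _ k, add_assoc]
    exact tsub_add_cancel_of_le (hS k)
  have hm : ∀ c, c ∉ range g → m c = if c = ⊤ then ⨅ k, s k else 0 :=
    fun c hc => extend_apply' _ _ _ hc
  have hRtop : R ⊤ = ⨅ k, s k := by
    have : (⊤ : Cost) ∉ range g := by rintro ⟨k, hk⟩; exact htop k hk
    simp [hR, hm _ this, hsome _ this]
  have hR0 : ∀ c, c ≠ ⊤ → c ∉ range g → R c = 0 := by
    intro c hc hcg
    simp [hR, hm _ hcg, hsome _ hcg, hc]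
  have hRsum : ∀ k, ∑' c, R c * (if g k ≤ c then 1 else 0) = s k := by
    intro k
    -- The sum is carried by `⊤` and by the grid points from the `k`-th one on.
    let i : Option ℕ → Cost := fun o => o.elim ⊤ fun j => g (k + j)
    have hi : Injective i := by
      rintro (_ | a) (_ | b) h
      · rfl
      · exact absurd h.symm (htop _)
      · exact absurd h (htop _)
      · simpa using hg.injective h
    rw [← hi.tsum_eq, tsum_option_eq_add, ← iInf_add_tsum_of_telescoping hRg k]
    · simp [i, hRtop, hg.le_iff_le]
    · intro c hc
      by_contra hci
      refine hc ?_
      by_cases hcg : c ∈ range g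
      · obtain ⟨j, rfl⟩ := hcg
        have : ¬ k ≤ j := fun hkj => hci ⟨some (j - k), by simp [i, hkj]⟩
        simp [hg.le_iff_le, this]
      · change R c * _ = 0
        rw [hR0 c (fun h => hci ⟨none, h.symm⟩) hcg, zero_mul]
  have hsum : ∀ w : Cost → ℝ≥0∞, ∑' o, f o * w o.2 = ∑' c, R c * w c := by
    intro w
    rw [ENNReal.tsum_prod', ENNReal.tsum_comm]
    simp only [ENNReal.tsum_mul_right, R]
  have htotal : ∑' o, f o = 1 := by
    have h := hsum fun c => if g 0 ≤ c then 1 else 0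
    rw [hRsum 0] at h
    simpa [h0, s] using h
  have hμsupp : ∀ o, f o ≠ 0 → o.2 = ⊤ ∨ o.2 ∈ range g := by
    intro o ho
    by_contra! h
    refine ho (le_zero_iff.1 ?_)
    rw [← hR0 o.2 h.1 h.2]
    exact ENNReal.le_tsum (f := fun a => f (a, o.2)) o.1
  obtain ⟨μ, hμ⟩ : ∃ μ : PMF Outcome, ∀ o, μ o = f o :=
    ⟨⟨f, htotal ▸ ENNReal.summable.hasSum⟩, fun _ => rfl⟩
  have hμs : ∀ o, μ o ≠ 0 → o.2 = ⊤ ∨ o.2 ∈ range g := fun o ho => hμsupp o (hμ o ▸ ho)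
  refine ⟨μ, fun v c => hμ (some v, c), fun c => ?_, hμs⟩
  rcases eq_or_ne c ⊤ with rfl | hc
  · simp [tail_top]
  obtain ⟨k, hk, hk'⟩ := exists_le_lt_succ h0 hcof hc
  have htailμ : tail μ c = s (k + 1) := by
    calc tail μ c = expect μ fun o => if g (k + 1) ≤ o.2 then 1 else 0 :=
          expect_congr fun o ho => if_congr (lt_iff_of_mem_grid hg (hμs o ho) hk hk') rfl rfl
      _ = ∑' o, f o * (if g (k + 1) ≤ o.2 then 1 else 0) := by simp only [expect, hμ]
      _ = s (k + 1) := by rw [hsum fun c => if g (k + 1) ≤ c then 1 else 0, hRsum]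
  rw [htailμ]
  refine iSup_congr fun n => expect_congr fun o ho => if_congr ?_ rfl rfl
  have ho' : o.2 = ⊤ ∨ o.2 ∈ range g := Or.inr (hsupp n o ho)
  exact (lt_iff_of_mem_grid hg ho' le_rfl (hg k.lt_succ_self)).trans
    (lt_iff_of_mem_grid hg ho' hk hk').symm

/-! ### The expected charge of the least upper bound -/

theorem gridPoint_strictMono {N : ℕ} (hN : 0 < N) : StrictMono (gridPoint N) := by
  intro j k hjk
  have : (0 : ℚ≥0) < N := by exact_mod_cast hN
  have : (j : ℚ≥0) < k := by exact_mod_cast hjk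
  exact WithTop.coe_lt_coe.2 (by gcongr)

theorem exists_lt_gridPoint {N : ℕ} (hN : 0 < N) (q : ℚ≥0) : ∃ k, (q : Cost) < gridPoint N k := by
  obtain ⟨k, hk⟩ := exists_nat_gt (q * N)
  have : (0 : ℚ≥0) < N := by exact_mod_cast hN
  exact ⟨k, WithTop.coe_lt_coe.2 ((lt_div_iff₀ this).2 hk)⟩

open scoped Classical in
/-- A cost on the grid is the sum of the grid steps below it. -/
theorem toENNReal_eq_tsum_gridPoint {N : ℕ} (hN : 0 < N) {c : Cost}
    (hc : c = ⊤ ∨ c ∈ range (gridPoint N)) :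
    c.toENNReal = ∑' k, ratToENNReal (1 / N) * (if gridPoint N k < c then 1 else 0) := by
  have hN' : (N : ℚ≥0) ≠ 0 := by exact_mod_cast hN.ne'
  rcases hc with rfl | ⟨j, rfl⟩
  · have h1 : ∀ k, gridPoint N k < ⊤ := fun k => WithTop.coe_lt_top _
    have h2 : ratToENNReal (1 / N) ≠ 0 := by simpa [ratToENNReal] using hN.ne'
    simp only [h1, if_true, mul_one]
    exact (ENNReal.tsum_const_eq_top_of_ne_zero h2).symm
  · simp only [(gridPoint_strictMono hN).lt_iff_lt]
    rw [tsum_eq_sum (s := Finset.range j) fun k hk => by simp_all,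
      Finset.sum_congr rfl fun k hk => by rw [if_pos (Finset.mem_range.1 hk), mul_one]]
    have h3 : (j / N : ℚ≥0) = ∑ _k ∈ Finset.range j, (1 / N : ℚ≥0) := by simp [div_eq_mul_inv]
    rw [gridPoint, Cost.toENNReal_coe, h3]
    simp [ratToENNReal]

/-- The part of the charge that is due to the potential of the result. -/
noncomputable def resultPotential (A : PTy) (o : Outcome) : ℝ≥0∞ :=
  o.1.elim 0 fun v => ratToENNReal (v.ppotential A)

/-- The expected charge, as a sum of tail probabilities and of probabilities of terminating
outcomes: the quantities that are monotone along a chain. -/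
theorem expect_charge_eq {N : ℕ} (hN : 0 < N) (A : PTy) {μ : PMF Outcome}
    (hμ : ∀ o, μ o ≠ 0 → o.2 = ⊤ ∨ o.2 ∈ range (gridPoint N)) :
    expect μ (charge A) = ∑' k, ratToENNReal (1 / N) * tail μ (gridPoint N k) +
      ∑' o, μ o * resultPotential A o := by
  classical
  simp only [tail, ← expect_const_mul, ← expect_tsum]
  rw [← expect, ← expect_add]
  refine expect_congr fun o ho => ?_
  rw [← toENNReal_eq_tsum_gridPoint hN (hμ o ho)]
  rcases o with ⟨_ | v, c⟩ <;> simp [charge, resultPotential, add_comm]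

theorem expect_charge_sup_le {N : ℕ} (hN : 0 < N) {A : PTy} {b : ℝ≥0∞} {μs : ℕ → PMF Outcome}
    {μ : PMF Outcome} (hchain : ∀ n, DistLE (μs n) (μs (n + 1)))
    (hb : ∀ n, Bounded N A b (μs n)) (hval : ∀ v c, μ (some v, c) = ⨆ n, μs n (some v, c))
    (htail : ∀ c, tail μ c = ⨆ n, tail (μs n) c)
    (hμ : ∀ o, μ o ≠ 0 → o.2 = ⊤ ∨ o.2 ∈ range (gridPoint N)) : expect μ (charge A) ≤ b := by
  have htm : ∀ k, Monotone fun n => ratToENNReal (1 / N) * tail (μs n) (gridPoint N k) :=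
    fun k => monotone_nat_of_le_succ fun n => mul_le_mul_right ((hchain n).tail_le _) _
  have hvm : ∀ o, Monotone fun n => μs n o * resultPotential A o := by
    rintro ⟨_ | v, c⟩
    · simp [resultPotential, monotone_const]
    · exact monotone_nat_of_le_succ fun n => mul_le_mul_left ((hchain n).1 v c) _
  have hv : ∀ o, μ o * resultPotential A o = ⨆ n, μs n o * resultPotential A o := by
    rintro ⟨_ | v, c⟩
    · simp [resultPotential]
    · rw [hval, ENNReal.iSup_mul]
  rw [expect_charge_eq hN A hμ]
  simp only [htail, ENNReal.mul_iSup, hv]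
  rw [tsum_iSup_of_monotone htm, tsum_iSup_of_monotone hvm, ENNReal.iSup_add_iSup_of_monotone
    (fun m n h => ENNReal.tsum_le_tsum fun k => htm k h)
    (fun m n h => ENNReal.tsum_le_tsum fun o => hvm o h)]
  refine iSup_le fun n => ?_
  rw [← expect_charge_eq hN A fun o ho => Or.inr ((hb n).grid o ho)]
  exact (hb n).charge_le

theorem expect_charge_eq_tsum (A : PTy) (μ : PMF Outcome) :
    expect μ (charge A) = (∑' q₀ : Cost, μ (none, q₀) * q₀.toENNReal) +
      ∑' o : Val × Cost, μ (some o.1, o.2) *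
        (ratToENNReal (o.1.ppotential A) + o.2.toENNReal) := by
  rw [expect, ENNReal.tsum_prod', tsum_option_eq_add, ENNReal.tsum_prod']
  rfl

end AARA

theorem mainTheorem1 (Γ : AARA.Ctx) (q : ℚ≥0) (e : AARA.Expr) (A : AARA.PTy) (V : AARA.Env)
    (he : AARA.Typing Γ q e A) (hV : V.HasCtx Γ) :
    (∃ μ : PMF AARA.Outcome, AARA.IsFullDist V e μ) ∧
    ∀ μ : PMF AARA.Outcome, AARA.IsFullDist V e μ →
      (∀ (v₀ : AARA.Val) (q₀ : AARA.Cost), μ (some v₀, q₀) ≠ 0 → v₀.Fits A.ty) ∧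
      (∑' q₀ : AARA.Cost, μ (none, q₀) * q₀.toENNReal) +
          (∑' o : AARA.Val × AARA.Cost, μ (some o.1, o.2) *
            (AARA.ratToENNReal (o.1.ppotential A) + o.2.toENNReal))
        ≤ V.potential Γ + AARA.ratToENNReal q := by
  obtain ⟨N, hN, heN, hVN⟩ : ∃ N, 0 < N ∧ e.OnGrid N ∧ V.GridCtx N Γ := by
    obtain ⟨N₁, h₁, g₁⟩ := e.exists_onGrid
    obtain ⟨N₂, h₂, g₂⟩ := AARA.Env.exists_gridCtx (V := V) he.finite_dom
      fun x τ hx => (hV x τ hx).exists_gridTyped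
    have h := Nat.mul_pos h₁ h₂
    exact ⟨N₁ * N₂, h, g₁.of_dvd h (dvd_mul_right _ _), g₂.of_dvd h (dvd_mul_left _ _)⟩
  choose μs hstep hb using fun n => he.exists_step n heN hVN
  have hchain : ∀ n, AARA.DistLE (μs n) (μs (n + 1)) := fun n => (hstep n).distLE (hstep (n + 1))
  obtain ⟨μ, hval, htail, hsupp⟩ := AARA.exists_sup_of_chain (AARA.gridPoint_strictMono hN)
    (AARA.gridPoint_zero N) (AARA.exists_lt_gridPoint hN) hchain fun n => (hb n).grid
  have hub : ∀ n, AARA.DistLE (μs n) μ := fun n => AARA.distLE_iff.2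
    ⟨fun v c => hval v c ▸ le_iSup (fun n => μs n (some v, c)) n,
      fun c => htail c ▸ le_iSup (fun n => AARA.tail (μs n) c) n⟩
  have hlub : ∀ ν, (∀ n, AARA.DistLE (μs n) ν) → AARA.DistLE μ ν := fun ν hν => AARA.distLE_iff.2
    ⟨fun v c => hval v c ▸ iSup_le fun n => (hν n).1 v c,
      fun c => htail c ▸ iSup_le fun n => (hν n).tail_le c⟩
  refine ⟨⟨μ, μs, hstep, hchain, hub, hlub⟩, ?_⟩
  rintro ν ⟨νs, hstep', -, hub', hlub'⟩
  -- The chain is determined by `V` and `e`, and its least upper bound by the chain.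
  obtain rfl : νs = μs := funext fun n => (hstep' n).unique (hstep n)
  obtain rfl : ν = μ := (hlub' μ hub).antisymm (hlub ν hub')
  refine ⟨fun v c hv => ?_, ?_⟩
  · rw [hval] at hv
    obtain ⟨n, hn⟩ : ∃ n, νs n (some v, c) ≠ 0 := by
      by_contra! h
      exact hv (by simp [h])
    exact ((hb n).typed v c hn).fits
  · rw [← AARA.expect_charge_eq_tsum]
    exact AARA.expect_charge_sup_le hN hchain hb hval htail hsupp
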